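/- **Calculus.** Let $a$ range over a countable set of channel names. Labels are $l^s$ with $l$ from a countable set of atomic labels and $s$ a finite binary string ($l=l^\epsilon$). Actions are $\alpha ::= a \mid \bar a \mid \tau \mid \omega$, where $\omega$ is a distinguished success action that is not a channel. CCS$_\sigma$ processes are $$P,Q ::= L{:}\alpha.P \mid P\,|\,Q \mid P+Q \mid L{:}\textstyle\sum_i p_iP_i \mid (\nu a)P \mid\, !P \mid 0 ,$$ with finite sums, $p_i\ge 0$, $\sum_i p_i=1$; $P+_pQ$ is the binary sum with weights $p,1-p$, $p\in[0,1]$. Schedulers are the terms $S::=\sigma(L).S\mid\sigma(L,L).S\mid\sum_iS_i\mid 0$ (finite sums), possibly of infinite length, but with only finitely many nested sums before the next $\sigma$. For a guard $\sigma(\cdot)$, the transitions of a complete process $P\parallel \sigma(\cdot).S$ are the least relation with: - ACT: $L{:}\alpha.P\parallel\sigma(L).S\xrightarrow{\alpha}\delta(P\parallel S)$; PROB: $L{:}\sum_ip_iP_i\parallel\sigma(L).S\xrightarrow{\tau}\sum_i[p_i]\,\delta(P_i\parallel S)$. - RES, SUM, PAR: a transition $P\parallel T\xrightarrow{\alpha}\mu$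 gives $(\nu a)P\parallel T\xrightarrow{\alpha}(\nu a)\mu$ if $\alpha\ne a,\bar a$; $P+Q\parallel T\xrightarrow{\alpha}\mu$; and $P\,|\,Q\parallel T\xrightarrow{\alpha}\mu\,|\,Q$; symmetrically for the right operand. - COM: if $P\parallel\sigma(L_1)\xrightarrow{\alpha}\delta(P'\parallel 0)$ and $Q\parallel\sigma(L_2)\xrightarrow{\bar\alpha}\delta(Q'\parallel 0)$ with $\alpha\in\{a,\bar a\}$, $\bar{\bar a}=a$, then $P\,|\,Q\parallel\sigma(L_1,L_2).S\xrightarrow{\tau}\delta(P'\,|\,Q'\parallel S)$. - BANG: if $P\parallel T\xrightarrow{\alpha}\mu$ then $!P\parallel T\xrightarrow{\alpha}\rho_0(\mu)\,|\,\rho_1(!P)$; and if $P\parallel\sigma(L_1)\xrightarrow{\alpha}\delta(P_1\parallel 0)$, $P\parallel\sigma(L_2)\xrightarrow{\bar\alpha}\delta(P_2\parallel 0)$ with $\alpha\in\{a,\bar a\}$, then $!P\parallel\sigma(L_1,L_2).S\xrightarrow{\tau}\delta(\rho_0(P_1)\,|\,\rho_{10}(P_2)\,|\,\rho_{11}(!P)\parallel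 S)$, where $\rho_k$ replaces every label $l^s$ by $l^{sk}$. A complete process $P\parallel\sum_iS_i$ has the transitions of $P\parallel S_i$ for the first $i$ for which $P\parallel S_i$ has any, and $P\parallel0$ has none. **Labelings.** The labeling of $P$ is *deterministic* if for every scheduler $S$ there is at most one transition $P\parallel S\xrightarrow{\alpha}\mu$, and the same holds for every process reachable from $P$ by transitions of positive probability. Two labels are *disjoint* unless they have the same atomic label and one index is a prefix of the other. The labeling of a process or context is *fresh* w.r.t. a set of processes if its labels are pairwise disjoint (for different occurrences) and disjoint from all labels of these processes. **Testing.** $(\nu)P$ is the restriction of $P$ on all its channels (not on $\omega$). $\mathit{Syn}(P)$ is the set of schedulers $S$ that are non-blocking for $P$: whenever a complete process reachable from $P\parallel S$ has no transition, its process component has no transition under any scheduler. A test w.r.t. a set of processes is a process in which $\omega$ occurs, with a deterministic labeling that is fresh w.r.t. that set. $p_\omega(P,S,O)$ is the probability of the set of executions of $(\nu)(P\,|\,O)\parallel S$ that contain $\omega$. Then $P\sqsubseteq_{\rm may}Q$ iff for all tests $O$ w.r.t. $\{P,Q\}$ and all $S_P\in \mathit{Syn}((\nu)(P|O))$ there is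 $S_Q\in \mathit{Syn}((\nu)(Q|O))$ with $p_\omega(P,S_P,O)\le p_\omega(Q,S_Q,O)$; and $P\sqsubseteq_{\rm must}Q$ iff for all such $O$ and all $S_Q\in \mathit{Syn}((\nu)(Q|O))$ there is $S_P\in \mathit{Syn}((\nu)(P|O))$ with $p_\omega(P,S_P,O)\le p_\omega(Q,S_Q,O)$. The equivalences $\approx_{\rm may}$, $\approx_{\rm must}$ are the symmetric parts of these preorders. **Theorem.** Let $P,Q$ be CCS$_\sigma$ processes with deterministic labelings, $p\in[0,1]$, $l,l_1$ labels, and let $C$ be a context (a process with one hole) in which $!$ does not occur and whose labeling is fresh w.r.t. $\{\,l_1{:}\tau.P,\ l_1{:}\tau.Q,\ l{:}(P+_pQ)\,\}$. Then $$l{:}\big(C[l_1{:}\tau.P]+_pC[l_1{:}\tau.Q]\big)\ \approx_{\rm may}\ C[l{:}(P+_pQ)]\quad\text{and}\quad l{:}\big(C[l_1{:}\tau.P]+_pC[l_1{:}\tau.Q]\big)\ \approx_{\rm must}\ C[l{:}(P+_pQ)].$$ -/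

import Mathlib

open scoped NNReal ENNReal

namespace CCS

/-- Channel names (a countable set). -/
abbrev Chan := ℕ

/-- Labels `l^s`: an atomic label `l` (from a countable set) with a finite binary index `s`. -/
structure Label where
  atom : ℕ
  idx : List Bool

/-- `(l^s)` extended by the string `k`, that is `l^{sk}`. -/
def Label.ext (L : Label) (k : List Bool) : Label := ⟨L.atom, L.idx ++ k⟩

/-- Two labels are disjoint if no label can be obtained from both of them by extending the
indexes. For labels with equally long (e.g. empty) indexes this just means that they differ. -/
def Label.Disj (L M : Label) : Prop :=
  ¬ (L.atom = M.atom ∧ (L.idx <+: M.idx ∨ M.idx <+: L.idx))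

/-- Prefixes / actions: input `a`, output `ā`, the silent action `τ`, and the distinguished
success action `ω` (which is not a channel). -/
inductive Act where
  | inp (a : Chan)
  | out (a : Chan)
  | tau
  | omega

/-- `α` and `β` are complementary visible actions `a`, `ā` (in either order). -/
def Act.Compl (α β : Act) : Prop :=
  ∃ a, (α = .inp a ∧ β = .out a) ∨ (α = .out a ∧ β = .inp a)

/-- The channel of an action, if any. -/
def Act.chan? : Act → Option Chan
  | .inp a => some a
  | .out a => some a
  | .tau => none
  | .omega => none

/-- Processes of CCS with explicit labels. In `psum l w P` (the internal probabilistic choice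
`l : ∑ i, p_i P_i`) the weights `p_i = w i` form a probability distribution on `Fin n`. -/
inductive Proc where
  | pre (l : Label) (α : Act) (P : Proc)
  | par (P Q : Proc)
  | sum (P Q : Proc)
  | psum {n : ℕ} (l : Label) (w : PMF (Fin n)) (P : Fin n → Proc)
  | res (a : Chan) (P : Proc)
  | bang (P : Proc)
  | nil

namespace Proc

/-- The binary probabilistic choice `l : (P +_p Q)`. -/
noncomputable def bsum (l : Label) (p : ℝ≥0) (hp : p ≤ 1) (P Q : Proc) : Proc :=
  .psum l
    (PMF.ofFintype ![(p : ℝ≥0∞), ((1 - p : ℝ≥0) : ℝ≥0∞)] (by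
      simp only [Fin.sum_univ_two, Matrix.cons_val_zero, Matrix.cons_val_one]
      rw [← ENNReal.coe_add, add_tsub_cancel_of_le hp, ENNReal.coe_one]))
    ![P, Q]

/-- The relabelling `ρ_k`, replacing every label `l^s` by `l^{sk}`. -/
def relabel (k : List Bool) : Proc → Proc
  | pre l α P => pre (l.ext k) α (P.relabel k)
  | par P Q => par (P.relabel k) (Q.relabel k)
  | sum P Q => sum (P.relabel k) (Q.relabel k)
  | psum l w P => psum (l.ext k) w (fun i => (P i).relabel k)
  | res a P => res a (P.relabel k)
  | bang P => bang (P.relabel k)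
  | nil => nil

/-- All occurrences of labels in a process. -/
def labels : Proc → List Label
  | pre l _ P => l :: P.labels
  | par P Q => P.labels ++ Q.labels
  | sum P Q => P.labels ++ Q.labels
  | psum l _ P => l :: (List.ofFn fun i => (P i).labels).flatten
  | res _ P => P.labels
  | bang P => P.labels
  | nil => []

/-- All occurrences of prefixes in a process. -/
def actions : Proc → List Act
  | pre _ α P => α :: P.actions
  | par P Q => P.actions ++ Q.actions
  | sum P Q => P.actions ++ Q.actions
  | psum _ _ P => (List.ofFn fun i => (P i).actions).flatten
  | res _ P => P.actions
  | bang P => P.actions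
  | nil => []

/-- The process contains no replication. -/
def BangFree : Proc → Prop
  | pre _ _ P => P.BangFree
  | par P Q => P.BangFree ∧ Q.BangFree
  | sum P Q => P.BangFree ∧ Q.BangFree
  | psum _ _ P => ∀ i, (P i).BangFree
  | res _ P => P.BangFree
  | bang _ => False
  | nil => True

/-- `(ν)P`: the restriction of `P` on all its channels. The action `ω` is not restricted. -/
def hide (P : Proc) : Proc := (P.actions.filterMap Act.chan?).foldr Proc.res P

end Proc

/-- A linear family of labels: the labels are pairwise disjoint. -/
def Linear (ls : List Label) : Prop := ls.Pairwise Label.Disj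

/-- A family of labels (the labeling of a process, test or context) is fresh with respect to a
set `Ps` of processes: it is linear and disjoint from the labels of the processes in `Ps`. -/
def FreshLabels (ls : List Label) (Ps : Set Proc) : Prop :=
  Linear ls ∧ ∀ L ∈ ls, ∀ R ∈ Ps, ∀ M ∈ R.labels, L.Disj M

/-! ### Contexts -/

/-- A context: a process with exactly one hole. In `psum l w i C P` the hole is in the
summand `i`, and `P j` is the summand `j` for `j ≠ i`. -/
inductive Ctx where
  | hole
  | pre (l : Label) (α : Act) (C : Ctx)
  | parL (C : Ctx) (R : Proc)
  | parR (R : Proc) (C : Ctx)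
  | sumL (C : Ctx) (R : Proc)
  | sumR (R : Proc) (C : Ctx)
  | psum {n : ℕ} (l : Label) (w : PMF (Fin n)) (i : Fin n) (C : Ctx)
      (P : {j : Fin n // j ≠ i} → Proc)
  | res (a : Chan) (C : Ctx)
  | bang (C : Ctx)

namespace Ctx

/-- `C[X]`. -/
def fill (X : Proc) : Ctx → Proc
  | hole => X
  | pre l α C => .pre l α (C.fill X)
  | parL C R => .par (C.fill X) R
  | parR R C => .par R (C.fill X)
  | sumL C R => .sum (C.fill X) R
  | sumR R C => .sum R (C.fill X)
  | psum l w i C P => .psum l w (fun j => if h : j = i then C.fill X else P ⟨j, h⟩)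
  | res a C => .res a (C.fill X)
  | bang C => .bang (C.fill X)

/-- The labels occurring in the context itself. -/
def labels (C : Ctx) : List Label := (C.fill .nil).labels

/-- The context contains no replication. -/
def BangFree (C : Ctx) : Prop := (C.fill .nil).BangFree

end Ctx

/-! ### Schedulers -/

/-- What a scheduler prefix selects: a single action, `σ(l)`, or a synchronization,
`σ(l₁, l₂)`. -/
inductive Guard where
  | one (l : Label)
  | two (l₁ l₂ : Label)

/-- A scheduler up to (and including) its first guards:
`0`, `σ(L).□`, `σ(L,L).□`, or a finite sum of such terms. -/
inductive SchedHead where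
  | nil
  | pre (g : Guard)
  | choice {n : ℕ} (h : Fin n → SchedHead)

/-- The occurrences of guards (equivalently, of continuations `□`) in a head. -/
def SchedHead.Pos : SchedHead → Type
  | .nil => Empty
  | .pre _ => Unit
  | .choice h => Σ i, (h i).Pos

/-- One layer of scheduler syntax. -/
abbrev SchedF : PFunctor.{0, 0} := ⟨SchedHead, SchedHead.Pos⟩

/-- Schedulers `S ::= σ(L).S | σ(L,L).S | ∑ i, S i | 0` of possibly infinite length (as needed
for processes with infinite executions): the possibly infinite terms over this grammar in which
infinitely many guards are met on every infinite branch. -/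
abbrev Sched := SchedF.M

/-! ### Operational semantics -/

/-- `Step P g α μ` means that `P ∥ g.S` makes, by the rules for processes, an `α`-transition to
the distribution of `P' ∥ S`, with `P'` distributed as `μ`. (No rule inspects or changes the
continuation `S` of the scheduler.) -/
inductive Step : Proc → Guard → Act → PMF Proc → Prop
  | act (l : Label) (α : Act) (P : Proc) :
      Step (.pre l α P) (.one l) α (PMF.pure P)
  | res {P : Proc} {g : Guard} {α : Act} {μ : PMF Proc} {a : Chan} :
      Step P g α μ → α ≠ .inp a → α ≠ .out a →
      Step (.res a P) g α (μ.map (Proc.res a))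
  | sum1 {P Q : Proc} {g : Guard} {α : Act} {μ : PMF Proc} :
      Step P g α μ → Step (.sum P Q) g α μ
  | sum2 {P Q : Proc} {g : Guard} {α : Act} {μ : PMF Proc} :
      Step Q g α μ → Step (.sum P Q) g α μ
  | par1 {P Q : Proc} {g : Guard} {α : Act} {μ : PMF Proc} :
      Step P g α μ → Step (.par P Q) g α (μ.map fun P' => .par P' Q)
  | par2 {P Q : Proc} {g : Guard} {α : Act} {μ : PMF Proc} :
      Step Q g α μ → Step (.par P Q) g α (μ.map fun Q' => .par P Q')
  | com {P Q P' Q' : Proc} {l₁ l₂ : Label} {α β : Act} :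
      Step P (.one l₁) α (PMF.pure P') → Step Q (.one l₂) β (PMF.pure Q') → α.Compl β →
      Step (.par P Q) (.two l₁ l₂) .tau (PMF.pure (.par P' Q'))
  | prob {n : ℕ} (l : Label) (w : PMF (Fin n)) (P : Fin n → Proc) :
      Step (.psum l w P) (.one l) .tau (w.map P)
  | bang1 {P : Proc} {g : Guard} {α : Act} {μ : PMF Proc} :
      Step P g α μ →
      Step (.bang P) g α
        (μ.map fun P' => .par (P'.relabel [false]) ((Proc.bang P).relabel [true]))
  | bang2 {P P₁ P₂ : Proc} {l₁ l₂ : Label} {α β : Act} :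
      Step P (.one l₁) α (PMF.pure P₁) → Step P (.one l₂) β (PMF.pure P₂) → α.Compl β →
      Step (.bang P) (.two l₁ l₂) .tau
        (PMF.pure (.par (.par (P₁.relabel [false]) (P₂.relabel [true, false]))
          ((Proc.bang P).relabel [true, true])))

/-- `Fires P h q α μ`: with a scheduler whose head is `h`, the process `P` makes an
`α`-transition to `μ`, and the scheduler continues at its guard `q`. In a scheduler choice the
first summand that allows the process to make a transition is used. -/
def Fires (P : Proc) : (h : SchedHead) → h.Pos → Act → PMF Proc → Prop
  | .nil, _, _, _ => False
  | .pre g, _, α, μ => Step P g α μ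
  | .choice h, ⟨i, q⟩, α, μ =>
      Fires P (h i) q α μ ∧ ∀ j < i, ∀ q' β ν, ¬ Fires P (h j) q' β ν

/-- Complete processes `P ∥ S`. -/
abbrev State := Proc × Sched

/-- The transition relation of complete processes. -/
def CStep (s : State) (α : Act) (m : PMF State) : Prop :=
  ∃ (q : s.2.head.Pos) (μ : PMF Proc),
    Fires s.1 s.2.head q α μ ∧ m = μ.map fun P' => (P', s.2.children q)

/-- `Reach s t`: the state `t` is reachable from `s` by transitions of positive probability. -/
inductive Reach (s : State) : State → Prop
  | refl : Reach s s
  | step {t u : State} {α : Act} {m : PMF State} :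
      Reach s t → CStep t α m → m u ≠ 0 → Reach s u

/-- `P'` is reachable from `P` by transitions of positive probability, under arbitrary
schedulers that may be changed at every step. -/
inductive PReach (P : Proc) : Proc → Prop
  | refl : PReach P P
  | step {P' P'' : Proc} {S S' : Sched} {α : Act} {m : PMF State} :
      PReach P P' → CStep (P', S) α m → m (P'', S') ≠ 0 → PReach P P''

/-- The labeling of `P` is deterministic: for every scheduler there is at most one transition
from `P`, and the same holds for all processes that can be reached from `P`. -/
def Deterministic (P : Proc) : Prop :=
  ∀ P', PReach P P' → ∀ (S : Sched) (α β : Act) (m m' : PMF State),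
    CStep (P', S) α m → CStep (P', S) β m' → α = β ∧ m = m'

/-- No scheduler allows `P` to make a transition. -/
def Blocked (P : Proc) : Prop := ∀ (S : Sched) (α : Act) (m : PMF State), ¬ CStep (P, S) α m

/-- `Syn P`: the schedulers that are non-blocking for `P`, i.e. that always schedule some
transition, except when the process itself is blocked. -/
def Syn (P : Proc) : Set Sched :=
  {S | ∀ t : State, Reach (P, S) t → (∃ α m, CStep t α m) ∨ Blocked t.1}

/-! ### Testing -/

/-- The probability that the automaton moves from `s` to `t` by the action `α`. (In a fully
probabilistic automaton the supremum is over at most one transition.) -/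
noncomputable def stepProb (s : State) (α : Act) (t : State) : ℝ≥0∞ :=
  ⨆ (m : PMF State) (_ : CStep s α m), m t

/-- The probability of the cone of the finite execution `s a₁ s₁ a₂ s₂ ⋯ aₙ sₙ`. -/
noncomputable def coneProb : State → List (Act × State) → ℝ≥0∞
  | _, [] => 1
  | s, (α, t) :: e => stepProb s α t * coneProb t e

/-- The last action of the finite execution is `ω`, and it is the first occurrence of `ω`. -/
def EndsAtFirstOmega (e : List (Act × State)) : Prop :=
  ∃ e' t, e = e' ++ [(Act.omega, t)] ∧ ∀ x ∈ e', x.1 ≠ Act.omega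

/-- `p_ω(P, S, O)`: the probability of the set of executions of `(ν)(P | O) ∥ S` that contain
`ω`, which is the disjoint union of the cones of the finite executions that end at their first
`ω`. -/
noncomputable def pOmega (P : Proc) (S : Sched) (O : Proc) : ℝ≥0∞ :=
  ∑' e : {e : List (Act × State) // EndsAtFirstOmega e},
    coneProb ((Proc.par P O).hide, S) e.1

/-- `O` is a test with respect to the set `Ps`: a process with a deterministic labeling that is
fresh with respect to `Ps`, containing the action `ω`. -/
def IsTest (Ps : Set Proc) (O : Proc) : Prop :=
  Deterministic O ∧ FreshLabels O.labels Ps ∧ Act.omega ∈ O.actions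

/-- The may-testing preorder. -/
def MayLE (P Q : Proc) : Prop :=
  ∀ O, IsTest {P, Q} O →
    ∀ S ∈ Syn (Proc.par P O).hide, ∃ T ∈ Syn (Proc.par Q O).hide,
      pOmega P S O ≤ pOmega Q T O

/-- The must-testing preorder. -/
def MustLE (P Q : Proc) : Prop :=
  ∀ O, IsTest {P, Q} O →
    ∀ T ∈ Syn (Proc.par Q O).hide, ∃ S ∈ Syn (Proc.par P O).hide,
      pOmega P S O ≤ pOmega Q T O

/-- May-testing equivalence. -/
def MayEquiv (P Q : Proc) : Prop := MayLE P Q ∧ MayLE Q P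

/-- Must-testing equivalence. -/
def MustEquiv (P Q : Proc) : Prop := MustLE P Q ∧ MustLE Q P

end CCS

/-! A stronger fact gives all four preorders at once: every non-blocking scheduler of one side is
matched by a non-blocking scheduler of the other with the same success probability (`Matches`).
Write `outer` for the process that resolves the choice before entering the context, `inner` for the
one that resolves it in the hole.

The heart is a comparison inside the context. Without replication the hole is never copied, and the
labels of context and test are disjoint from those of the process in the hole. So every transition
either belongs to the surroundings, and is then the same whatever the hole contains, or is the
single silent step of the process in the hole (`HoleCtx.step_cases`). Until that step, a scheduler
cannot tell the summands apart. The step itself leads from the weighted family `l₁ : τ.P i` and from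
the one process `l : ∑ i, w i P i` to the same mixture of residuals. Hence the average success
probability over the family equals that of the single process, provided the scheduler exchanges `l₁`
and `l` until the hole has moved (`expect_val_swapUntil`). Exchanging back and forth also preserves
non-blocking schedulers (`live_swapUntil`).

A scheduler of `inner` is matched by resolving the outer choice at once and then running the
exchanged scheduler. Conversely, a scheduler of `outer` may run the test for a while, or forever,
before it fires `l`. The scheduler `postpone` copies these moves of the test and, where `l` would
fire, continues directly with the exchanged scheduler. The two runs differ by the one step spent on
the outer choice. This is invisible in the limit, because the success probability is the supremum
over `n` of the probability `val n` of success within `n` steps (`pOmega_eq_iSup_val`). -/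

namespace CCS

/-! ### Schedulers as lists of leaves -/

/-- The occurrences of guards in a head, from left to right, with a value for each of them. -/
def SchedHead.leaves {X : Type} : (h : SchedHead) → (h.Pos → X) → List (Guard × X)
  | .nil, _ => []
  | .pre g, k => [(g, k ())]
  | .choice (n := n) h, k =>
      (List.finRange n).flatMap fun i => (h i).leaves fun q => k ⟨i, q⟩

/-- The first guards of a scheduler, from left to right, with their continuations. -/
def Sched.leaves (S : Sched) : List (Guard × Sched) := S.head.leaves S.children

/-- The process can make a transition by the guard `g`. -/
def Proc.Enabled (P : Proc) (g : Guard) : Prop := ∃ α μ, Step P g α μ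

open Classical in
/-- The first leaf whose guard allows `P` to make a transition. -/
noncomputable def Proc.pick {X : Type} (P : Proc) (L : List (Guard × X)) :
    Option (Guard × X) :=
  L.find? fun y => decide (P.Enabled y.1)

theorem findSome?_finRange_eq_some {β : Type*} {n : ℕ} {f : Fin n → Option β} {b : β} :
    (List.finRange n).findSome? f = some b ↔ ∃ i, f i = some b ∧ ∀ j < i, f j = none := by
  induction n with
  | zero => simp
  | succ n ih =>
    rw [List.finRange_succ, List.findSome?_cons, Fin.exists_fin_succ]
    cases h0 : f 0 with
    | some c =>
      simp only [Option.some.injEq, Fin.not_lt_zero, false_imp_iff, implies_true, and_true,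
        Fin.forall_fin_succ, Fin.succ_pos, forall_const, h0, reduceCtorEq, false_and, and_false,
        exists_false, or_false]
    | none =>
      rw [List.findSome?_map, ih]
      simp [Fin.forall_fin_succ, h0]

/-- Using the first summand that can move, through all nested sums, is a left-to-right search in the
flattened list of guards. Thus the tree shape of a head never matters, only its list of leaves. -/
theorem exists_fires_iff {X : Type} {P : Proc} {α : Act} {μ : PMF Proc} (h : SchedHead)
    (k : h.Pos → X) (x : X) :
    (∃ q, Fires P h q α μ ∧ k q = x) ↔
      ∃ g, P.pick (h.leaves k) = some (g, x) ∧ Step P g α μ := by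
  classical
  induction h generalizing α μ x with
  | nil => simp [SchedHead.leaves, Proc.pick, Fires]
  | pre g =>
    constructor
    · rintro ⟨q, hq, rfl⟩
      have hq : Step P g α μ := hq
      refine ⟨g, ?_, hq⟩
      have : P.Enabled g := ⟨_, _, hq⟩
      simp only [SchedHead.leaves, Proc.pick, List.find?_singleton, this, decide_true, if_true]
      rfl
    · rintro ⟨g', hg, hs⟩
      simp only [SchedHead.leaves, Proc.pick, List.find?_singleton] at hg
      split at hg
      · simp only [Option.some.injEq, Prod.mk.injEq] at hg
        exact ⟨(), by rw [← hg.1] at hs; exact hs, hg.2⟩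
      · cases hg
  | choice h ih =>
    have key : ∀ j, (∀ (q' : (h j).Pos) β ν, ¬ Fires P (h j) q' β ν) ↔
        P.pick ((h j).leaves fun q => k ⟨j, q⟩) = none := by
      intro j
      constructor
      · intro hj
        by_contra hne
        obtain ⟨⟨g, y⟩, hgy⟩ := Option.ne_none_iff_exists'.1 hne
        have hen := List.find?_some hgy
        obtain ⟨β, ν, hs⟩ := of_decide_eq_true hen
        obtain ⟨q, hq, -⟩ := (ih j (fun q => k ⟨j, q⟩) y).2 ⟨g, hgy, hs⟩
        exact hj q β ν hq
      · intro hn q β ν hq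
        obtain ⟨g, hg, -⟩ := (ih j (fun q => k ⟨j, q⟩) _).1 ⟨q, hq, rfl⟩
        rw [hn] at hg
        cases hg
    have hp : P.pick (SchedHead.leaves (.choice h) k) =
        (List.finRange _).findSome? fun i => P.pick ((h i).leaves fun q => k ⟨i, q⟩) := by
      simp only [Proc.pick, SchedHead.leaves, List.find?_flatMap]
    simp only [hp, findSome?_finRange_eq_some]
    constructor
    · rintro ⟨⟨i, q⟩, ⟨hf, hj⟩, rfl⟩
      obtain ⟨g, hg, hs⟩ := (ih i (fun q => k ⟨i, q⟩) _).1 ⟨q, hf, rfl⟩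
      exact ⟨g, ⟨i, hg, fun j hji => (key j).1 (hj j hji)⟩, hs⟩
    · rintro ⟨g, ⟨i, hg, hj⟩, hs⟩
      obtain ⟨q, hq, hk⟩ := (ih i (fun q => k ⟨i, q⟩) _).2 ⟨g, hg, hs⟩
      exact ⟨⟨i, q⟩, ⟨hq, fun j hji => (key j).2 (hj j hji)⟩, hk⟩

theorem cstep_iff {P : Proc} {S : Sched} {α : Act} {m : PMF State} :
    CStep (P, S) α m ↔ ∃ g T μ, P.pick S.leaves = some (g, T) ∧ Step P g α μ ∧
      m = μ.map fun P' => (P', T) := by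
  constructor
  · rintro ⟨q, μ, hf, rfl⟩
    obtain ⟨g, hg, hs⟩ := (exists_fires_iff S.head S.children _).1 ⟨q, hf, rfl⟩
    exact ⟨g, _, μ, hg, hs, rfl⟩
  · rintro ⟨g, T, μ, hg, hs, rfl⟩
    obtain ⟨q, hf, rfl⟩ := (exists_fires_iff S.head S.children T).2 ⟨g, hg, hs⟩
    exact ⟨q, μ, hf, rfl⟩

theorem Proc.enabled_of_pick {X : Type} {P : Proc} {L : List (Guard × X)} {g : Guard} {x : X}
    (h : P.pick L = some (g, x)) : P.Enabled g := by
  classical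
  exact of_decide_eq_true
    (List.find?_some (p := fun y : Guard × X => decide (P.Enabled y.1)) h)

theorem exists_cstep_iff {P : Proc} {S : Sched} :
    (∃ α m, CStep (P, S) α m) ↔ P.pick S.leaves ≠ none := by
  constructor
  · rintro ⟨α, m, h⟩
    obtain ⟨g, T, μ, hg, -, -⟩ := cstep_iff.1 h
    simp [hg]
  · intro h
    obtain ⟨⟨g, T⟩, hg⟩ := Option.ne_none_iff_exists'.1 h
    obtain ⟨α, μ, hs⟩ := Proc.enabled_of_pick hg
    exact ⟨α, _, cstep_iff.2 ⟨g, T, μ, hg, hs, rfl⟩⟩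

theorem cstep_congr_of_pick_eq {P : Proc} {S T : Sched} (h : P.pick S.leaves = P.pick T.leaves)
    (α : Act) (m : PMF State) : CStep (P, S) α m ↔ CStep (P, T) α m := by
  rw [cstep_iff, cstep_iff, h]

/-! ### Coinductive construction of schedulers from lists of leaves. -/

/-- The layer of scheduler syntax that offers the leaves in the list `L`. -/
def SchedF.ofList {X : Type} (L : List (Guard × X)) : SchedF X :=
  ⟨.choice fun i : Fin L.length => .pre (L.get i).1, fun q => (L.get q.1).2⟩

theorem leaves_ofList {X Y : Type} (L : List (Guard × X)) (f : X → Y) :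
    (SchedF.ofList L).1.leaves (fun q => f ((SchedF.ofList L).2 q)) =
      L.map fun y => (y.1, f y.2) := by
  simp only [SchedF.ofList, SchedHead.leaves]
  conv_rhs => rw [← List.map_get_finRange L, List.map_map]
  rw [List.map_eq_flatMap]
  rfl

/-- One step of `Sched.unfold`. -/
def Sched.unfoldLayer {X : Type} (step : X → List (Guard × (X ⊕ Sched))) :
    X ⊕ Sched → SchedF (X ⊕ Sched)
  | .inl x => SchedF.ofList (step x)
  | .inr S => SchedF.map Sum.inr S.dest

/-- The scheduler generated by `step`, which lists the leaves of a state. A leaf continues with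
another state or with a given scheduler. -/
def Sched.unfold {X : Type} (step : X → List (Guard × (X ⊕ Sched))) (x : X) : Sched :=
  PFunctor.M.corec (Sched.unfoldLayer step) (.inl x)

/-- A bisimulation: once a leaf hands over to a given scheduler, the corecursion only copies it. -/
theorem corec_unfoldLayer_inr {X : Type} (step : X → List (Guard × (X ⊕ Sched))) (S : Sched) :
    PFunctor.M.corec (Sched.unfoldLayer step) (.inr S) = S := by
  refine PFunctor.M.bisim
    (fun A B => A = PFunctor.M.corec (Sched.unfoldLayer step) (.inr B)) ?_ _ _ rfl
  rintro _ B rfl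
  rw [PFunctor.M.dest_corec]
  exact ⟨B.head, fun q => PFunctor.M.corec (Sched.unfoldLayer step) (.inr (B.children q)),
    B.children, rfl, rfl, fun _ => rfl⟩

theorem leaves_of_dest_eq {S : Sched} {Z : SchedF Sched} (h : S.dest = Z) :
    S.leaves = Z.1.leaves Z.2 := by
  subst h
  rfl

theorem leaves_unfold {X : Type} (step : X → List (Guard × (X ⊕ Sched))) (x : X) :
    (Sched.unfold step x).leaves =
      (step x).map fun y => (y.1, Sum.elim (Sched.unfold step) id y.2) := by
  have h := PFunctor.M.dest_corec (Sched.unfoldLayer step) (.inl x)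
  have h2 := leaves_ofList (step x) (PFunctor.M.corec (Sched.unfoldLayer step))
  rw [Sched.unfold, leaves_of_dest_eq h]
  refine h2.trans ?_
  congr 1
  funext y
  rcases y with ⟨g, x | S⟩
  · rfl
  · simp [corec_unfoldLayer_inr]

theorem exists_sched_leaves_eq (L : List (Guard × Sched)) : ∃ S : Sched, S.leaves = L := by
  refine ⟨Sched.unfold (X := Unit) (fun _ => L.map fun y => (y.1, .inr y.2)) (), ?_⟩
  rw [leaves_unfold, List.map_map]
  simp [Function.comp_def]

/-! ### Expectations -/

/-- The expectation of `φ` under `μ`. -/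
noncomputable def expect {α : Type*} (μ : PMF α) (φ : α → ℝ≥0∞) : ℝ≥0∞ := ∑' a, μ a * φ a

theorem expect_bind {α β : Type*} (μ : PMF α) (κ : α → PMF β) (φ : β → ℝ≥0∞) :
    expect (μ.bind κ) φ = expect μ fun a => expect (κ a) φ := by
  simp only [expect, PMF.bind_apply, ← ENNReal.tsum_mul_right, ← ENNReal.tsum_mul_left]
  rw [ENNReal.tsum_comm]
  simp only [mul_assoc]

theorem expect_pure {α : Type*} (a : α) (φ : α → ℝ≥0∞) : expect (PMF.pure a) φ = φ a := by
  rw [expect, tsum_eq_single a]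
  · simp
  · intro b hb
    simp [hb]

theorem expect_map {α β : Type*} (μ : PMF α) (f : α → β) (φ : β → ℝ≥0∞) :
    expect (μ.map f) φ = expect μ fun a => φ (f a) := by
  simp only [← PMF.bind_pure_comp, expect_bind, Function.comp_apply, expect_pure]

theorem expect_const {α : Type*} (μ : PMF α) (c : ℝ≥0∞) : expect μ (fun _ => c) = c := by
  rw [expect, ENNReal.tsum_mul_right, PMF.tsum_coe, one_mul]

theorem expect_mono {α : Type*} (μ : PMF α) {φ ψ : α → ℝ≥0∞} (h : ∀ a ∈ μ.support, φ a ≤ ψ a) :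
    expect μ φ ≤ expect μ ψ := by
  refine ENNReal.tsum_le_tsum fun a => ?_
  by_cases ha : μ a = 0
  · simp [ha]
  · exact mul_le_mul_right (h a ((PMF.mem_support_iff μ a).2 ha)) _

theorem expect_congr {α : Type*} (μ : PMF α) {φ ψ : α → ℝ≥0∞}
    (h : ∀ a ∈ μ.support, φ a = ψ a) : expect μ φ = expect μ ψ :=
  le_antisymm (expect_mono μ fun a ha => (h a ha).le) (expect_mono μ fun a ha => (h a ha).ge)

theorem expect_comm {α β : Type*} (μ : PMF α) (ν : PMF β) (φ : α → β → ℝ≥0∞) :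
    (expect μ fun a => expect ν fun b => φ a b) = expect ν fun b => expect μ fun a => φ a b := by
  simp only [expect, ← ENNReal.tsum_mul_left]
  rw [ENNReal.tsum_comm]
  simp only [mul_left_comm]

theorem map_apply_of_injective {α β : Type*} (μ : PMF α) {f : α → β} (hf : f.Injective) (a : α) :
    μ.map f (f a) = μ a := by
  classical
  rw [PMF.map_apply, tsum_eq_single a]
  · simp
  · intro b hb
    rw [if_neg]
    exact fun h => hb (hf h.symm)

/-! ### The probability of `ω` within a number of steps -/

open Classical in
/-- The probability that `ω` occurs within the first `n` steps. -/
noncomputable def val : ℕ → State → ℝ≥0∞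
  | 0, _ => 0
  | n + 1, s => ∑' x : Act × State, stepProb s x.1 x.2 * if x.1 = .omega then 1 else val n x.2

/-- Monotonicity absorbs the one-step shifts that arise when the outer choice is resolved at another
moment. -/
theorem val_mono (s : State) : Monotone fun n => val n s := by
  classical
  refine monotone_nat_of_le_succ fun n => ?_
  induction n generalizing s with
  | zero => simp [val]
  | succ n ih =>
    rw [val, val]
    refine ENNReal.tsum_le_tsum fun x => ?_
    gcongr
    split_ifs
    · exact le_rfl
    · exact ih _

/-! ### Sums over executions that end at their first `ω`. -/

theorem not_endsAtFirstOmega_nil : ¬ EndsAtFirstOmega [] := by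
  rintro ⟨e', t, h, -⟩
  simp at h

theorem endsAtFirstOmega_cons {x : Act × State} {e : List (Act × State)} :
    EndsAtFirstOmega (x :: e) ↔
      (x.1 = .omega ∧ e = []) ∨ (x.1 ≠ .omega ∧ EndsAtFirstOmega e) := by
  constructor
  · rintro ⟨_ | ⟨y, e'⟩, t, h, hne⟩
    · simp only [List.nil_append, List.cons.injEq] at h
      exact .inl ⟨by rw [h.1], h.2⟩
    · simp only [List.cons_append, List.cons.injEq] at h
      obtain ⟨rfl, rfl⟩ := h
      exact .inr ⟨hne x (by simp), e', t, rfl, fun z hz => hne z (by simp [hz])⟩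
  · rintro (⟨hx, rfl⟩ | ⟨hx, e', t, rfl, hne⟩)
    · exact ⟨[], x.2, by rw [← hx]; rfl, by simp⟩
    · refine ⟨x :: e', t, rfl, fun z hz => ?_⟩
      rcases List.mem_cons.1 hz with rfl | hz
      · exact hx
      · exact hne z hz

theorem tsum_list_of_nil {α : Type*} (f : List α → ℝ≥0∞) (h : f [] = 0) :
    ∑' e, f e = ∑' x, ∑' e, f (x :: e) := by
  rw [← ENNReal.tsum_prod (f := fun x e => f (x :: e))]
  refine (Function.Injective.tsum_eq (g := fun y : α × List α => y.1 :: y.2) ?_ ?_).symm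
  · rintro ⟨a, b⟩ ⟨c, d⟩ h
    simpa using h
  · rintro (_ | ⟨x, e⟩) he
    · exact absurd h he
    · exact ⟨(x, e), rfl⟩

open Classical in
theorem tsum_coneProb_length_le (n : ℕ) (s : State) :
    (∑' e : List (Act × State),
      if EndsAtFirstOmega e ∧ e.length ≤ n then coneProb s e else 0) = val n s := by
  induction n generalizing s with
  | zero =>
    rw [val, ENNReal.tsum_eq_zero]
    rintro (_ | ⟨x, e⟩)
    · simp [not_endsAtFirstOmega_nil]
    · simp
  | succ n ih =>
    rw [tsum_list_of_nil _ (by simp [not_endsAtFirstOmega_nil]), val]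
    congr 1
    funext x
    by_cases hx : x.1 = .omega
    · rw [tsum_eq_single []]
      · simp [endsAtFirstOmega_cons, hx, coneProb]
      · intro e he
        simp [endsAtFirstOmega_cons, hx, he]
    · rw [if_neg hx, ← ih, ← ENNReal.tsum_mul_left]
      simp [endsAtFirstOmega_cons, hx, coneProb]

/-- The cones of length at most `n` exhaust all cones as `n` grows, and their total is `val n`. This
turns a sum over executions into a quantity accessible to induction on the number of steps. -/
theorem pOmega_eq_iSup_val (P : Proc) (S : Sched) (O : Proc) :
    pOmega P S O = ⨆ n, val n ((Proc.par P O).hide, S) := by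
  classical
  simp only [← tsum_coneProb_length_le]
  refine (tsum_subtype {e | EndsAtFirstOmega e} (coneProb _)).trans ?_
  refine le_antisymm ?_ (iSup_le fun n => ENNReal.tsum_le_tsum fun e => ?_)
  · rw [ENNReal.tsum_eq_iSup_sum]
    refine iSup_le fun F => ?_
    -- A finite set of executions is already counted when the bound is the greatest length occurring
    -- in it.
    refine le_iSup_of_le (F.sup List.length) ?_
    refine le_trans (Finset.sum_le_sum fun e he => ?_) (ENNReal.sum_le_tsum F)
    have hle : e.length ≤ F.sup List.length := Finset.le_sup (f := List.length) he
    simp [Set.indicator_apply, hle]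
  · by_cases he : EndsAtFirstOmega e <;> simp [he]
    split_ifs <;> simp

theorem stepProb_congr {P : Proc} {S T : Sched} (h : P.pick S.leaves = P.pick T.leaves) :
    stepProb (P, S) = stepProb (P, T) := by
  funext α t
  simp only [stepProb, cstep_congr_of_pick_eq h]

theorem val_congr {P : Proc} {S T : Sched} (h : P.pick S.leaves = P.pick T.leaves) (n : ℕ) :
    val n (P, S) = val n (P, T) := by
  cases n with
  | zero => rfl
  | succ n => simp only [val, stepProb_congr h]

theorem val_of_pick_eq_none {P : Proc} {S : Sched} (h : P.pick S.leaves = none) (n : ℕ) :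
    val n (P, S) = 0 := by
  cases n with
  | zero => rfl
  | succ n =>
    have h0 : ∀ α m, ¬ CStep (P, S) α m := fun α m hs =>
      exists_cstep_iff.1 ⟨α, m, hs⟩ h
    simp [val, stepProb, h0]

/-- `P` has at most one transition by the guard `g`. -/
def UniqueStep (P : Proc) (g : Guard) : Prop :=
  ∀ α β μ ν, Step P g α μ → Step P g β ν → α = β ∧ μ = ν

open Classical in
-- Uniqueness leaves at most one transition in each supremum of `stepProb`, so the sum defining
-- `val` collapses to an average over `μ`.
theorem val_succ_of_step {P : Proc} {S T : Sched} {g : Guard} {α : Act} {μ : PMF Proc}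
    (hp : P.pick S.leaves = some (g, T)) (hs : Step P g α μ) (hu : UniqueStep P g) (n : ℕ) :
    val (n + 1) (P, S) =
      if α = .omega then 1 else expect μ fun P' => val n (P', T) := by
  have hstep : ∀ β t, stepProb (P, S) β t =
      if β = α then μ.map (fun P' => (P', T)) t else 0 := by
    intro β t
    have hiff : ∀ m, CStep (P, S) β m ↔ β = α ∧ m = μ.map fun P' => (P', T) := by
      intro m
      rw [cstep_iff]
      constructor
      · rintro ⟨g', T', ν, hp', hs', rfl⟩
        rw [hp, Option.some.injEq, Prod.mk.injEq] at hp'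
        obtain ⟨rfl, rfl⟩ := hp'
        obtain ⟨rfl, rfl⟩ := hu _ _ _ _ hs hs'
        exact ⟨rfl, rfl⟩
      · rintro ⟨rfl, rfl⟩
        exact ⟨g, T, μ, hp, hs, rfl⟩
    simp only [stepProb, hiff]
    split_ifs with h <;> simp [h]
  rw [val, ENNReal.tsum_prod', tsum_eq_single α]
  · simp only [hstep, if_true]
    split_ifs
    · simp only [mul_one]
      exact PMF.tsum_coe _
    · exact expect_map μ (fun P' => (P', T)) (val n)
  · intro β hβ
    simp [hstep, hβ]

/-! ### Non-blocking schedulers -/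

/-- The scheduler of the complete process `s` is non-blocking for its process. -/
def Live (s : State) : Prop :=
  ∀ t, Reach s t → (∃ α m, CStep t α m) ∨ Blocked t.1

theorem mem_syn_iff {P : Proc} {S : Sched} : S ∈ Syn P ↔ Live (P, S) := Iff.rfl

theorem Reach.head {s t u : State} {α : Act} {m : PMF State} (h : CStep s α m) (ht : m t ≠ 0)
    (hu : Reach t u) : Reach s u := by
  induction hu with
  | refl => exact .step .refl h ht
  | step _ h2 hm ih => exact .step ih h2 hm

theorem Live.of_cstep {s t : State} {α : Act} {m : PMF State} (hs : Live s) (h : CStep s α m)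
    (ht : m t ≠ 0) : Live t := fun _ hu => hs _ (Reach.head h ht hu)

theorem live_coinduction (I : State → Prop)
    (hlocal : ∀ s, I s → (∃ α m, CStep s α m) ∨ Blocked s.1)
    (hstep : ∀ s, I s → ∀ α m, CStep s α m → ∀ t, m t ≠ 0 → I t) {s : State} (hs : I s) :
    Live s := by
  intro t ht
  refine hlocal t ?_
  induction ht with
  | refl => exact hs
  | step _ h hm ih => exact hstep _ ih _ _ h _ hm

theorem blocked_iff {P : Proc} : Blocked P ↔ ∀ g, ¬ P.Enabled g := by
  classical
  constructor
  · rintro h g ⟨α, μ, hs⟩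
    -- Any continuation will do. The one-leaf scheduler for `g` then shows that an enabled guard
    -- prevents the process from being blocked.
    obtain ⟨T, -⟩ := exists_sched_leaves_eq []
    obtain ⟨S, hS⟩ := exists_sched_leaves_eq [(g, T)]
    refine h S α _ (cstep_iff.2 ⟨g, T, μ, ?_, hs, rfl⟩)
    have : P.Enabled g := ⟨_, _, hs⟩
    simp [hS, Proc.pick, this]
  · intro h S α m hs
    obtain ⟨g, T, μ, -, hs, -⟩ := cstep_iff.1 hs
    exact h g ⟨_, _, hs⟩

theorem Live.local {P : Proc} {S : Sched} (h : Live (P, S)) :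
    P.pick S.leaves ≠ none ∨ ∀ g, ¬ P.Enabled g := by
  rw [← exists_cstep_iff, ← blocked_iff]
  exact h _ .refl

theorem Live.of_step {P P' : Proc} {S T : Sched} {g : Guard} {α : Act} {μ : PMF Proc}
    (h : Live (P, S)) (hp : P.pick S.leaves = some (g, T)) (hs : Step P g α μ)
    (hP' : P' ∈ μ.support) : Live (P', T) := by
  refine h.of_cstep (cstep_iff.2 ⟨g, T, μ, hp, hs, rfl⟩) ?_
  exact (PMF.mem_support_iff _ _).1 ((PMF.mem_support_map_iff _ _ _).2 ⟨P', hP', rfl⟩)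

/-- A form of coinduction in terms of the rules for processes. -/
theorem live_of_invariant (I : Proc → Sched → Prop)
    (hlocal : ∀ P S, I P S → P.pick S.leaves ≠ none ∨ ∀ g, ¬ P.Enabled g)
    (hstep : ∀ P S, I P S → ∀ g T α μ, P.pick S.leaves = some (g, T) → Step P g α μ →
      ∀ P' ∈ μ.support, I P' T ∨ Live (P', T)) {P : Proc} {S : Sched} (h : I P S) :
    Live (P, S) := by
  refine live_coinduction (fun s => I s.1 s.2 ∨ Live s) ?_ ?_ (.inl h)
  · rintro ⟨P, S⟩ (hs | hs)
    · rw [exists_cstep_iff, blocked_iff]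
      exact hlocal P S hs
    · exact hs _ .refl
  · rintro ⟨P, S⟩ (hs | hs) α m hst t ht
    · obtain ⟨g, T, μ, hp, hst', rfl⟩ := cstep_iff.1 hst
      obtain ⟨P', hP', rfl⟩ :=
        (PMF.mem_support_map_iff _ _ _).1 ((PMF.mem_support_iff _ _).2 ht)
      exact hstep P S hs g T α μ hp hst' P' hP'
    · exact .inr (hs.of_cstep hst ht)

/-! ### Restriction on several channels -/

/-- The restriction on all channels in a list. -/
def Proc.resAll (as : List Chan) (P : Proc) : Proc := as.foldr Proc.res P

theorem Proc.resAll_injective (as : List Chan) : Function.Injective (Proc.resAll as) := by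
  induction as with
  | nil => exact fun _ _ h => h
  | cons a as ih =>
    intro P Q h
    exact ih (by simpa [Proc.resAll] using h)

theorem step_resAll_iff {as : List Chan} {P : Proc} {g : Guard} {α : Act} {μ : PMF Proc} :
    Step (P.resAll as) g α μ ↔ (∀ a ∈ as, α ≠ .inp a ∧ α ≠ .out a) ∧
      ∃ μ', Step P g α μ' ∧ μ = μ'.map (Proc.resAll as) := by
  induction as generalizing μ with
  | nil =>
    have : Proc.resAll [] = id := rfl
    simp [this, PMF.map_id]
  | cons a as ih =>
    have hc : Proc.resAll (a :: as) = Proc.res a ∘ Proc.resAll as := rfl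
    constructor
    · intro h
      rw [hc] at h
      simp only [Function.comp_apply] at h
      cases h with
      | res h h1 h2 =>
        obtain ⟨h3, μ', h4, rfl⟩ := ih.1 h
        refine ⟨fun b hb => ?_, μ', h4, ?_⟩
        · rcases List.mem_cons.1 hb with rfl | hb
          · exact ⟨h1, h2⟩
          · exact h3 b hb
        · rw [hc, PMF.map_comp]
    · rintro ⟨h, μ', h4, rfl⟩
      rw [hc, ← PMF.map_comp]
      exact .res (ih.2 ⟨fun b hb => h b (by simp [hb]), μ', h4, rfl⟩) (h a (by simp)).1
        (h a (by simp)).2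

theorem enabled_resAll_iff {as : List Chan} {P : Proc} {g : Guard} :
    (P.resAll as).Enabled g ↔
      ∃ α, (∀ a ∈ as, α ≠ .inp a ∧ α ≠ .out a) ∧ ∃ μ, Step P g α μ := by
  constructor
  · rintro ⟨α, μ, h⟩
    obtain ⟨h1, μ', h2, -⟩ := step_resAll_iff.1 h
    exact ⟨α, h1, μ', h2⟩
  · rintro ⟨α, h1, μ', h2⟩
    exact ⟨α, _, step_resAll_iff.2 ⟨h1, μ', h2, rfl⟩⟩

/-- Only the set of restricted channels counts. This is needed because `hide` restricts a list of
channel occurrences, and the outer choice contains one copy of the context per summand, so its list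
differs from that of the inner choice in order and multiplicity. -/
theorem enabled_resAll_congr {as bs : List Chan} (h : ∀ a, a ∈ as ↔ a ∈ bs) (P : Proc) :
    (P.resAll as).Enabled = (P.resAll bs).Enabled := by
  funext g
  simp only [enabled_resAll_iff, h]

theorem pick_resAll_congr {as bs : List Chan} (h : ∀ a, a ∈ as ↔ a ∈ bs) (P : Proc)
    (L : List (Guard × Sched)) : (P.resAll as).pick L = (P.resAll bs).pick L := by
  rw [Proc.pick, Proc.pick, enabled_resAll_congr h]

theorem cstep_resAll_iff {as : List Chan} {P : Proc} {S : Sched} {α : Act} {m : PMF State} :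
    CStep (P.resAll as, S) α m ↔ ∃ g T μ, (P.resAll as).pick S.leaves = some (g, T) ∧
      (∀ a ∈ as, α ≠ .inp a ∧ α ≠ .out a) ∧ Step P g α μ ∧
        m = (μ.map fun P' => (P', T)).map (Prod.map (Proc.resAll as) id) := by
  rw [cstep_iff]
  constructor
  · rintro ⟨g, T, μ, hp, hs, rfl⟩
    obtain ⟨h1, μ', h2, rfl⟩ := step_resAll_iff.1 hs
    exact ⟨g, T, μ', hp, h1, h2, by rw [PMF.map_comp, PMF.map_comp]; rfl⟩
  · rintro ⟨g, T, μ, hp, h1, h2, rfl⟩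
    exact ⟨g, T, _, hp, step_resAll_iff.2 ⟨h1, μ, h2, rfl⟩, by
      rw [PMF.map_comp, PMF.map_comp]; rfl⟩

theorem stepProb_resAll_le {as bs : List Chan} (h : ∀ a, a ∈ as ↔ a ∈ bs) (P P' : Proc)
    (S T : Sched) (α : Act) :
    stepProb (P.resAll as, S) α (P'.resAll as, T) ≤
      stepProb (P.resAll bs, S) α (P'.resAll bs, T) := by
  refine iSup₂_le fun m hm => ?_
  obtain ⟨g, T', μ, hp, h1, h2, rfl⟩ := cstep_resAll_iff.1 hm
  rw [pick_resAll_congr h] at hp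
  refine le_iSup₂_of_le _ (cstep_resAll_iff.2 ⟨g, T', μ, hp, ?_, h2, rfl⟩) ?_
  · exact fun a ha => h1 a ((h a).2 ha)
  · have hinj := fun cs => Function.Injective.prodMap (Proc.resAll_injective cs)
      (Function.injective_id (α := Sched))
    have e := fun cs => map_apply_of_injective (μ.map fun P' => (P', T')) (hinj cs) (P', T)
    exact ((e as).trans (e bs).symm).le

/-- The reachable states for the two lists are different terms, so both sums are indexed by the
process beneath the restrictions. No mass is lost: every state reached with positive probability
still carries the same restrictions. -/
theorem val_resAll_le {as bs : List Chan} (h : ∀ a, a ∈ as ↔ a ∈ bs) (n : ℕ) (P : Proc)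
    (S : Sched) : val n (P.resAll as, S) ≤ val n (P.resAll bs, S) := by
  classical
  induction n generalizing P S with
  | zero => exact le_rfl
  | succ n ih =>
    have hinj : ∀ cs, Function.Injective fun x : Act × State => (x.1, x.2.1.resAll cs, x.2.2) := by
      rintro cs ⟨a, P, S⟩ ⟨b, Q, T⟩ h
      simp only [Prod.mk.injEq] at h
      rw [h.1, Proc.resAll_injective cs h.2.1, h.2.2]
    rw [val, val]
    rw [← (hinj as).tsum_eq]
    · refine le_trans (ENNReal.tsum_le_tsum fun x => ?_)
        (ENNReal.tsum_comp_le_tsum_of_injective (hinj bs) _)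
      refine mul_le_mul' (stepProb_resAll_le h _ _ _ _ _) ?_
      split_ifs
      · exact le_rfl
      · exact ih _ _
    · rintro ⟨α, t⟩ hx
      have h0 : stepProb (P.resAll as, S) α t ≠ 0 := left_ne_zero_of_mul hx
      simp only [stepProb, ne_eq, ENNReal.iSup_eq_zero, not_forall] at h0
      obtain ⟨m, hm, hmt⟩ := h0
      obtain ⟨g, T', μ, -, -, -, rfl⟩ := cstep_resAll_iff.1 hm
      obtain ⟨u, -, rfl⟩ :=
        (PMF.mem_support_map_iff _ _ _).1 ((PMF.mem_support_iff _ _).2 hmt)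
      exact ⟨(α, u), rfl⟩

theorem val_resAll_congr {as bs : List Chan} (h : ∀ a, a ∈ as ↔ a ∈ bs) (n : ℕ) (P : Proc)
    (S : Sched) : val n (P.resAll as, S) = val n (P.resAll bs, S) :=
  le_antisymm (val_resAll_le h n P S) (val_resAll_le (fun a => (h a).symm) n P S)

theorem live_resAll_congr {as bs : List Chan} (h : ∀ a, a ∈ as ↔ a ∈ bs) {P : Proc} {S : Sched}
    (hl : Live (P.resAll as, S)) : Live (P.resAll bs, S) := by
  refine live_of_invariant (fun R S => ∃ P, R = P.resAll bs ∧ Live (P.resAll as, S)) ?_ ?_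
    ⟨P, rfl, hl⟩
  · rintro _ S ⟨P, rfl, hl⟩
    rw [← pick_resAll_congr h, ← enabled_resAll_congr h]
    exact hl.local
  · rintro _ S ⟨P, rfl, hl⟩ g T α μ hp hs P' hP'
    obtain ⟨h1, μ', h2, rfl⟩ := step_resAll_iff.1 hs
    obtain ⟨P', hP₁, rfl⟩ := (PMF.mem_support_map_iff _ _ _).1 hP'
    refine .inl ⟨P', rfl, hl.of_step (by rwa [pick_resAll_congr h])
      (step_resAll_iff.2 ⟨fun a ha => h1 a ((h a).1 ha), μ', h2, rfl⟩) ?_⟩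
    exact (PMF.mem_support_map_iff _ _ _).2 ⟨P', hP₁, rfl⟩

/-! ### Labels of reachable processes -/

/-- Every label in `ms` is an extension of a label in `ls`. -/
def Covers (ls ms : List Label) : Prop :=
  ∀ M ∈ ms, ∃ L ∈ ls, L.atom = M.atom ∧ L.idx <+: M.idx

/-- Every label in `ls` is disjoint from every label in `ms`. -/
def LDisj (ls ms : List Label) : Prop := ∀ L ∈ ls, ∀ M ∈ ms, L.Disj M

theorem Label.Disj.symm {L M : Label} (h : L.Disj M) : M.Disj L :=
  fun ⟨h1, h2⟩ => h ⟨h1.symm, h2.symm⟩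

theorem Label.not_disj_self (L : Label) : ¬ L.Disj L :=
  fun h => h ⟨rfl, .inl (List.prefix_refl _)⟩

theorem Label.Disj.extend {L M L' M' : Label} (h : L.Disj M) (hL : L.atom = L'.atom)
    (hL' : L.idx <+: L'.idx) (hM : M.atom = M'.atom) (hM' : M.idx <+: M'.idx) : L'.Disj M' := by
  rintro ⟨h1, h2⟩
  refine h ⟨by rw [hL, hM, h1], ?_⟩
  rcases h2 with h2 | h2
  · exact List.prefix_or_prefix_of_prefix (hL'.trans h2) hM'
  · exact List.prefix_or_prefix_of_prefix hL' (hM'.trans h2)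

theorem LDisj.symm {ls ms : List Label} (h : LDisj ls ms) : LDisj ms ls :=
  fun L hL M hM => (h M hM L hL).symm

/-- Transitions only drop labels or extend their indexes. Disjointness in the prefix sense survives
extension, so it is an invariant of execution, even for tests with replication. -/
theorem LDisj.of_covers {ls ms ls' ms' : List Label} (h : LDisj ls ms) (h1 : Covers ls ls')
    (h2 : Covers ms ms') : LDisj ls' ms' := by
  intro L hL M hM
  obtain ⟨L₀, hL₀, e1, e2⟩ := h1 L hL
  obtain ⟨M₀, hM₀, e3, e4⟩ := h2 M hM
  exact (h L₀ hL₀ M₀ hM₀).extend e1 e2 e3 e4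

theorem LDisj.mono {ls ms ls' ms' : List Label} (h : LDisj ls ms) (h1 : ls' ⊆ ls)
    (h2 : ms' ⊆ ms) : LDisj ls' ms' :=
  fun L hL M hM => h L (h1 hL) M (h2 hM)

theorem LDisj.not_mem {ls ms : List Label} (h : LDisj ls ms) {L : Label} (h1 : L ∈ ls) : L ∉ ms :=
  fun h2 => L.not_disj_self (h L h1 L h2)

theorem Covers.of_subset {ls ms : List Label} (h : ms ⊆ ls) : Covers ls ms :=
  fun M hM => ⟨M, h hM, rfl, List.prefix_refl _⟩

theorem Covers.refl (ls : List Label) : Covers ls ls := .of_subset (List.Subset.refl _)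

theorem Covers.trans {ls ms ns : List Label} (h1 : Covers ls ms) (h2 : Covers ms ns) :
    Covers ls ns := by
  intro N hN
  obtain ⟨M, hM, e1, e2⟩ := h2 N hN
  obtain ⟨L, hL, e3, e4⟩ := h1 M hM
  exact ⟨L, hL, e3.trans e1, e4.trans e2⟩

theorem Covers.append {ls ms ls' ms' : List Label} (h1 : Covers ls ls') (h2 : Covers ms ms') :
    Covers (ls ++ ms) (ls' ++ ms') := by
  intro M hM
  rcases List.mem_append.1 hM with hM | hM
  · obtain ⟨L, hL, h⟩ := h1 M hM
    exact ⟨L, List.mem_append_left _ hL, h⟩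
  · obtain ⟨L, hL, h⟩ := h2 M hM
    exact ⟨L, List.mem_append_right _ hL, h⟩

theorem covers_append_right {ls ms ns : List Label} :
    Covers ls (ms ++ ns) ↔ Covers ls ms ∧ Covers ls ns := by
  simp only [Covers, List.mem_append, or_imp, forall_and]

theorem labels_relabel (P : Proc) (k : List Bool) :
    (P.relabel k).labels = P.labels.map fun L => L.ext k := by
  induction P with
  | psum l w P ih =>
    simp only [Proc.relabel, Proc.labels, List.map_cons, List.map_flatten, List.map_ofFn]
    congr 4
    funext i
    exact ih i
  | _ => simp_all [Proc.relabel, Proc.labels]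

theorem covers_relabel (P : Proc) (k : List Bool) : Covers P.labels (P.relabel k).labels := by
  rw [labels_relabel]
  intro M hM
  obtain ⟨L, hL, rfl⟩ := List.mem_map.1 hM
  exact ⟨L, hL, rfl, List.prefix_append _ _⟩

/-- The labels in a guard. -/
def Guard.labels : Guard → List Label
  | .one l => [l]
  | .two l m => [l, m]

theorem Step.guard_subset {P : Proc} {g : Guard} {α : Act} {μ : PMF Proc} (h : Step P g α μ) :
    g.labels ⊆ P.labels := by
  induction h with
  | act => simp [Guard.labels, Proc.labels]
  | prob => simp [Guard.labels, Proc.labels]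
  | res _ _ _ ih => exact ih
  | sum1 _ ih => exact List.subset_append_of_subset_left _ ih
  | sum2 _ ih => exact List.subset_append_of_subset_right _ ih
  | par1 _ ih => exact List.subset_append_of_subset_left _ ih
  | par2 _ ih => exact List.subset_append_of_subset_right _ ih
  | bang1 _ ih => exact ih
  | com _ _ _ ih1 ih2 | bang2 _ _ _ ih1 ih2 =>
    simp only [Guard.labels, List.cons_subset, List.nil_subset, and_true] at ih1 ih2 ⊢
    simp [Proc.labels, ih1, ih2]

theorem labels_psum_subset {n : ℕ} (l : Label) (w : PMF (Fin n)) (P : Fin n → Proc) (i : Fin n) :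
    (P i).labels.Sublist (Proc.psum l w P).labels := by
  refine List.Sublist.cons _ (List.sublist_flatten_of_mem ?_)
  exact List.mem_ofFn.2 ⟨i, rfl⟩

theorem Step.covers {P : Proc} {g : Guard} {α : Act} {μ : PMF Proc} (h : Step P g α μ) :
    ∀ P' ∈ μ.support, Covers P.labels P'.labels := by
  induction h with
  | act l α P =>
    simp only [PMF.support_pure, Set.mem_singleton_iff, forall_eq]
    exact .of_subset (List.subset_cons_self _ _)
  | prob l w P =>
    simp only [PMF.support_map, Set.forall_mem_image]
    exact fun i _ => .of_subset (labels_psum_subset l w P i).subset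
  | res _ _ _ ih =>
    simp only [PMF.support_map, Set.forall_mem_image]
    exact ih
  | sum1 _ ih => exact fun P' h => (Covers.of_subset (List.subset_append_left _ _)).trans (ih P' h)
  | sum2 _ ih => exact fun P' h => (Covers.of_subset (List.subset_append_right _ _)).trans (ih P' h)
  | par1 _ ih =>
    simp only [PMF.support_map, Set.forall_mem_image]
    exact fun P' h => (ih P' h).append (.refl _)
  | par2 _ ih =>
    simp only [PMF.support_map, Set.forall_mem_image]
    exact fun P' h => (Covers.refl _).append (ih P' h)
  | com _ _ _ ih1 ih2 =>
    simp only [PMF.support_pure, Set.mem_singleton_iff, forall_eq] at ih1 ih2 ⊢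
    exact ih1.append ih2
  | bang1 _ ih =>
    simp only [PMF.support_map, Set.forall_mem_image]
    exact fun P' h => covers_append_right.2
      ⟨(ih P' h).trans (covers_relabel _ _), covers_relabel (.bang _) _⟩
  | bang2 _ _ _ ih1 ih2 =>
    simp only [PMF.support_pure, Set.mem_singleton_iff, forall_eq] at ih1 ih2 ⊢
    exact covers_append_right.2 ⟨covers_append_right.2 ⟨ih1.trans (covers_relabel _ _),
      ih2.trans (covers_relabel _ _)⟩, covers_relabel (.bang _) _⟩

/-- Proper randomness enters only through `prob`, whose action is silent. -/
theorem Step.eq_pure {P : Proc} {g : Guard} {α : Act} {μ : PMF Proc} (h : Step P g α μ)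
    (hα : α ≠ .tau) : ∃ P', μ = PMF.pure P' := by
  induction h with
  | act l α P => exact ⟨P, rfl⟩
  | sum1 _ ih => exact ih hα
  | sum2 _ ih => exact ih hα
  | res _ _ _ ih | par1 _ ih | par2 _ ih | bang1 _ ih =>
    obtain ⟨P', rfl⟩ := ih hα
    exact ⟨_, PMF.pure_map _ _⟩
  | prob | com | bang2 => exact absurd rfl hα

theorem Act.Compl.ne_tau {α β : Act} (h : α.Compl β) : α ≠ .tau ∧ β ≠ .tau := by
  obtain ⟨a, ⟨rfl, rfl⟩ | ⟨rfl, rfl⟩⟩ := h <;> simp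

theorem pure_injective {α : Type*} : Function.Injective (PMF.pure : α → PMF α) := by
  intro a b h
  have := congrArg PMF.support h
  simpa [PMF.support_pure] using this

/-! ### Deterministic labelings -/

/-- `P` has at most one transition by every guard. -/
def StepDet (P : Proc) : Prop := ∀ g, UniqueStep P g

/-- The processes reachable from `P` have at most one transition by every guard. -/
def StepsDet (P : Proc) : Prop := ∀ P', PReach P P' → StepDet P'

theorem cstep_of_step {P : Proc} {g : Guard} {α : Act} {μ : PMF Proc} (h : Step P g α μ)
    {S T : Sched} (hS : S.leaves = [(g, T)]) : CStep (P, S) α (μ.map fun P' => (P', T)) := by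
  classical
  have : P.Enabled g := ⟨_, _, h⟩
  exact cstep_iff.2 ⟨g, T, μ, by simp [hS, Proc.pick, this], h, rfl⟩

/-- One-leaf schedulers isolate single guards. The projection to the process component recovers the
distribution of processes from that of complete processes. -/
theorem Deterministic.stepsDet {P : Proc} (h : Deterministic P) : StepsDet P := by
  intro P' hP' g α β μ ν h1 h2
  obtain ⟨T, -⟩ := exists_sched_leaves_eq []
  obtain ⟨S, hS⟩ := exists_sched_leaves_eq [(g, T)]
  obtain ⟨e1, e2⟩ := h P' hP' S α β _ _ (cstep_of_step h1 hS) (cstep_of_step h2 hS)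
  refine ⟨e1, ?_⟩
  have := congrArg (PMF.map Prod.fst) e2
  rw [PMF.map_comp, PMF.map_comp] at this
  exact (PMF.map_id μ).symm.trans (this.trans (PMF.map_id ν))

theorem PReach.head {P P' P'' : Proc} {g : Guard} {α : Act} {μ : PMF Proc} (h : Step P g α μ)
    (hP' : P' ∈ μ.support) (h' : PReach P' P'') : PReach P P'' := by
  induction h' with
  | refl =>
    obtain ⟨T, -⟩ := exists_sched_leaves_eq []
    obtain ⟨S, hS⟩ := exists_sched_leaves_eq [(g, T)]
    refine .step (S' := T) .refl (cstep_of_step h hS) ?_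
    exact (PMF.mem_support_iff _ _).1 ((PMF.mem_support_map_iff _ _ _).2 ⟨P', hP', rfl⟩)
  | step _ h2 hm ih => exact .step ih h2 hm

theorem StepsDet.of_step {P P' : Proc} {g : Guard} {α : Act} {μ : PMF Proc} (hP : StepsDet P)
    (h : Step P g α μ) (hP' : P' ∈ μ.support) : StepsDet P' :=
  fun _ h' => hP _ (h'.head h hP')

theorem StepsDet.stepDet {P : Proc} (hP : StepsDet P) : StepDet P := hP P .refl

theorem stepDet_nil : StepDet .nil := fun _ _ _ _ _ h => nomatch h

theorem stepDet_pre (l : Label) (α : Act) (P : Proc) : StepDet (.pre l α P) := by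
  intro g β γ μ ν h1 h2
  cases h1
  cases h2
  exact ⟨rfl, rfl⟩

theorem stepDet_psum {n : ℕ} (l : Label) (w : PMF (Fin n)) (P : Fin n → Proc) :
    StepDet (.psum l w P) := by
  intro g β γ μ ν h1 h2
  cases h1
  cases h2
  exact ⟨rfl, rfl⟩

theorem StepDet.res {P : Proc} (h : StepDet P) (a : Chan) : StepDet (.res a P) := by
  intro g β γ μ ν h1 h2
  cases h1 with
  | res h1 =>
    cases h2 with
    | res h2 =>
      obtain ⟨rfl, rfl⟩ := h g _ _ _ _ h1 h2
      exact ⟨rfl, rfl⟩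

theorem Step.not_both {P Q : Proc} {g : Guard} {α β : Act} {μ ν : PMF Proc}
    (hd : LDisj P.labels Q.labels) (h1 : Step P g α μ) (h2 : Step Q g β ν) : False := by
  cases g with
  | one l | two l m =>
    exact hd.not_mem (h1.guard_subset (List.mem_cons_self ..))
      (h2.guard_subset (List.mem_cons_self ..))

theorem StepDet.sum {P Q : Proc} (hP : StepDet P) (hQ : StepDet Q)
    (hd : LDisj P.labels Q.labels) : StepDet (.sum P Q) := by
  intro g β γ μ ν h1 h2
  cases h1 with
  | sum1 h1 =>
    cases h2 with
    | sum1 h2 => exact hP g _ _ _ _ h1 h2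
    | sum2 h2 => exact (h1.not_both hd h2).elim
  | sum2 h1 =>
    cases h2 with
    | sum1 h2 => exact (h2.not_both hd h1).elim
    | sum2 h2 => exact hQ g _ _ _ _ h1 h2

theorem Step.left_of_two {P : Proc} {l m : Label} {α β : Act} {μ ν : PMF Proc} {Q : Proc}
    (hd : LDisj P.labels Q.labels) (h1 : Step P (.two l m) α μ) (h2 : Step Q (.one m) β ν) :
    False :=
  hd.not_mem (h1.guard_subset (by simp [Guard.labels] : m ∈ Guard.labels (.two l m)))
    (h2.guard_subset (List.mem_cons_self ..))

theorem Step.right_of_two {P : Proc} {l m : Label} {α β : Act} {μ ν : PMF Proc} {Q : Proc}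
    (hd : LDisj P.labels Q.labels) (h1 : Step P (.one l) α μ) (h2 : Step Q (.two l m) β ν) :
    False :=
  hd.not_mem (h1.guard_subset (List.mem_cons_self ..))
    (h2.guard_subset (List.mem_cons_self ..))

/-- The labels of a guard reveal who moves: a component moving alone uses only its own labels, while
a communication takes one label from each side. Disjointness excludes every overlap. -/
theorem StepDet.par {P Q : Proc} (hP : StepDet P) (hQ : StepDet Q)
    (hd : LDisj P.labels Q.labels) : StepDet (.par P Q) := by
  intro g β γ μ ν h1 h2
  cases h1 with
  | par1 h1 =>
    cases h2 with
    | par1 h2 =>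
      obtain ⟨rfl, rfl⟩ := hP g _ _ _ _ h1 h2
      exact ⟨rfl, rfl⟩
    | par2 h2 => exact (h1.not_both hd h2).elim
    | com h2 h3 => exact (h1.left_of_two hd h3).elim
  | par2 h1 =>
    cases h2 with
    | par1 h2 => exact (h2.not_both hd h1).elim
    | par2 h2 =>
      obtain ⟨rfl, rfl⟩ := hQ g _ _ _ _ h1 h2
      exact ⟨rfl, rfl⟩
    | com h2 h3 => exact (h2.right_of_two hd h1).elim
  | com h1 h3 =>
    cases h2 with
    | par1 h2 => exact (h2.left_of_two hd h3).elim
    | par2 h2 => exact (h1.right_of_two hd h2).elim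
    | com h2 h4 =>
      have e1 := pure_injective (hP _ _ _ _ _ h1 h2).2
      have e2 := pure_injective (hQ _ _ _ _ _ h3 h4).2
      subst e1 e2
      exact ⟨rfl, rfl⟩

/-- Without replication nothing is copied or relabelled, so a transition only deletes occurrences of
labels and linearity is inherited. -/
theorem Step.bangFree {P : Proc} {g : Guard} {α : Act} {μ : PMF Proc} (h : Step P g α μ)
    (hP : P.BangFree) : ∀ P' ∈ μ.support, P'.BangFree ∧ P'.labels.Sublist P.labels := by
  induction h with
  | act l α P =>
    simp only [PMF.support_pure, Set.mem_singleton_iff, forall_eq]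
    exact ⟨hP, List.sublist_cons_self _ _⟩
  | prob l w P =>
    simp only [PMF.support_map, Set.forall_mem_image]
    exact fun i _ => ⟨hP i, labels_psum_subset l w P i⟩
  | res _ _ _ ih =>
    simp only [PMF.support_map, Set.forall_mem_image]
    exact ih hP
  | sum1 _ ih =>
    exact fun P' h => ⟨(ih hP.1 P' h).1, (ih hP.1 P' h).2.trans (List.sublist_append_left _ _)⟩
  | sum2 _ ih =>
    exact fun P' h => ⟨(ih hP.2 P' h).1, (ih hP.2 P' h).2.trans (List.sublist_append_right _ _)⟩
  | par1 _ ih =>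
    simp only [PMF.support_map, Set.forall_mem_image]
    exact fun P' h => ⟨⟨(ih hP.1 P' h).1, hP.2⟩, (ih hP.1 P' h).2.append (.refl _)⟩
  | par2 _ ih =>
    simp only [PMF.support_map, Set.forall_mem_image]
    exact fun P' h => ⟨⟨hP.1, (ih hP.2 P' h).1⟩,
      (List.Sublist.refl _).append (ih hP.2 P' h).2⟩
  | com _ _ _ ih1 ih2 =>
    simp only [PMF.support_pure, Set.mem_singleton_iff, forall_eq] at ih1 ih2 ⊢
    exact ⟨⟨(ih1 hP.1).1, (ih2 hP.2).1⟩, (ih1 hP.1).2.append (ih2 hP.2).2⟩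
  | bang1 | bang2 => exact hP.elim

theorem linear_append {ls ms : List Label} :
    Linear (ls ++ ms) ↔ Linear ls ∧ Linear ms ∧ LDisj ls ms := List.pairwise_append

theorem stepDet_of_linear {P : Proc} (hP : P.BangFree) (hl : Linear P.labels) : StepDet P := by
  induction P with
  | pre l α P => exact stepDet_pre l α P
  | psum l w P => exact stepDet_psum l w P
  | nil => exact stepDet_nil
  | bang => exact hP.elim
  | res a P ih => exact (ih hP hl).res a
  | sum P Q ihP ihQ =>
    obtain ⟨h1, h2, h3⟩ := linear_append.1 hl
    exact (ihP hP.1 h1).sum (ihQ hP.2 h2) h3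
  | par P Q ihP ihQ =>
    obtain ⟨h1, h2, h3⟩ := linear_append.1 hl
    exact (ihP hP.1 h1).par (ihQ hP.2 h2) h3

theorem stepsDet_of_linear {P : Proc} (hP : P.BangFree) (hl : Linear P.labels) : StepsDet P := by
  suffices h : ∀ P', PReach P P' → P'.BangFree ∧ Linear P'.labels from
    fun P' hP' => stepDet_of_linear (h P' hP').1 (h P' hP').2
  intro P' h
  induction h with
  | refl => exact ⟨hP, hl⟩
  | step _ hs hm ih =>
    obtain ⟨g, T, μ, -, hst, rfl⟩ := cstep_iff.1 hs
    obtain ⟨R, hR, h⟩ := (PMF.mem_support_map_iff _ _ _).1 ((PMF.mem_support_iff _ _).2 hm)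
    obtain ⟨rfl, rfl⟩ := Prod.mk.inj h
    have := hst.bangFree ih.1 R hR
    exact ⟨this.1, ih.2.sublist this.2⟩

/-! ### Contexts as functions -/

/-- Contexts with at most one active hole, as functions of the process in the hole. The other
components have deterministic labelings, and their labels are disjoint from those of the part
with the hole where both can be active. -/
inductive HoleCtx : (Proc → Proc) → Prop
  | hole : HoleCtx fun X => X
  | const {R : Proc} : StepsDet R → HoleCtx fun _ => R
  | pre {F : Proc → Proc} (l : Label) (α : Act) : HoleCtx F → HoleCtx fun X => .pre l α (F X)
  | psum {n : ℕ} (l : Label) (w : PMF (Fin n)) {F : Fin n → Proc → Proc} :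
      (∀ i, HoleCtx (F i)) → HoleCtx fun X => .psum l w fun i => F i X
  | res {F : Proc → Proc} (a : Chan) : HoleCtx F → HoleCtx fun X => .res a (F X)
  | parL {F : Proc → Proc} {R : Proc} : HoleCtx F → StepsDet R →
      LDisj (F .nil).labels R.labels → HoleCtx fun X => .par (F X) R
  | parR {F : Proc → Proc} {R : Proc} : HoleCtx F → StepsDet R →
      LDisj (F .nil).labels R.labels → HoleCtx fun X => .par R (F X)
  | sumL {F : Proc → Proc} {R : Proc} : HoleCtx F → StepsDet R →
      LDisj (F .nil).labels R.labels → HoleCtx fun X => .sum (F X) R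
  | sumR {F : Proc → Proc} {R : Proc} : HoleCtx F → StepsDet R →
      LDisj (F .nil).labels R.labels → HoleCtx fun X => .sum R (F X)

/-- A transition of the context `F` that does not involve the process in the hole. -/
def CtxStep (F : Proc → Proc) (g : Guard) (α : Act) (ν : PMF (Proc → Proc)) : Prop :=
  (∀ X, Step (F X) g α (ν.map fun G => G X)) ∧ (∀ G ∈ ν.support, HoleCtx G) ∧
    (α ≠ .tau → ∃ G, ν = PMF.pure G)

/-- The context `F` lets the process in the hole make silent transitions, and then becomes `H`. -/
def HoleStep (F H : Proc → Proc) : Prop :=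
  ∀ X a μ, Step X (.one a) .tau μ → Step (F X) (.one a) .tau (μ.map H)

/-- The only transition of `X` is a silent one to `χ`, with the label `a`. -/
def HoleProc (X : Proc) (a : Label) (χ : PMF Proc) : Prop :=
  ∀ g α μ, Step X g α μ ↔ g = .one a ∧ α = .tau ∧ μ = χ

theorem holeProc_pre (l : Label) (P : Proc) : HoleProc (.pre l .tau P) l (PMF.pure P) := by
  intro g α μ
  constructor
  · intro h
    cases h
    exact ⟨rfl, rfl, rfl⟩
  · rintro ⟨rfl, rfl, rfl⟩
    exact .act _ _ _

theorem holeProc_psum {n : ℕ} (l : Label) (w : PMF (Fin n)) (P : Fin n → Proc) :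
    HoleProc (.psum l w P) l (w.map P) := by
  intro g α μ
  constructor
  · intro h
    cases h
    exact ⟨rfl, rfl, rfl⟩
  · rintro ⟨rfl, rfl, rfl⟩
    exact .prob _ _ _

theorem HoleProc.step {X : Proc} {a : Label} {χ : PMF Proc} (h : HoleProc X a χ) :
    Step X (.one a) .tau χ := (h _ _ _).2 ⟨rfl, rfl, rfl⟩

theorem HoleProc.mem_labels {X : Proc} {a : Label} {χ : PMF Proc} (h : HoleProc X a χ) :
    a ∈ X.labels := h.step.guard_subset (List.mem_cons_self ..)

theorem HoleProc.stepDet {X : Proc} {a : Label} {χ : PMF Proc} (h : HoleProc X a χ) :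
    StepDet X := by
  intro g α β μ ν h1 h2
  obtain ⟨-, rfl, rfl⟩ := (h _ _ _).1 h1
  obtain ⟨-, rfl, rfl⟩ := (h _ _ _).1 h2
  exact ⟨rfl, rfl⟩

theorem HoleCtx.mem_labels {F : Proc → Proc} (hF : HoleCtx F) {X : Proc} {M : Label}
    (h : M ∈ (F X).labels) : M ∈ (F .nil).labels ∨ M ∈ X.labels := by
  induction hF with
  | hole => exact .inr h
  | const => exact .inl h
  | res a _ ih => exact ih h
  | pre l α _ ih =>
    simp only [Proc.labels, List.mem_cons] at h ⊢
    tauto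
  | psum l w _ ih =>
    simp only [Proc.labels, List.mem_cons, List.mem_flatten, List.mem_ofFn] at h ⊢
    rcases h with h | ⟨_, ⟨i, rfl⟩, h⟩
    · exact .inl (.inl h)
    · exact (ih i h).imp (fun h => .inr ⟨_, ⟨i, rfl⟩, h⟩) id
  | parL _ _ _ ih | parR _ _ _ ih | sumL _ _ _ ih | sumR _ _ _ ih =>
    simp only [Proc.labels, List.mem_append] at h ⊢
    tauto

theorem HoleCtx.ldisj {F : Proc → Proc} (hF : HoleCtx F) {X : Proc} {ls : List Label}
    (h1 : LDisj (F .nil).labels ls) (h2 : LDisj ls X.labels) : LDisj (F X).labels ls := by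
  intro M hM
  rcases hF.mem_labels hM with h | h
  · exact h1 M h
  · exact h2.symm M h

theorem HoleCtx.stepDet {F : Proc → Proc} (hF : HoleCtx F) {X : Proc} (hX : StepDet X)
    (hd : LDisj (F .nil).labels X.labels) : StepDet (F X) := by
  induction hF with
  | hole => exact hX
  | const h => exact h.stepDet
  | pre l α => exact stepDet_pre _ _ _
  | psum l w => exact stepDet_psum _ _ _
  | res a _ ih => exact (ih hd).res a
  | parL hF hR hFR ih =>
    have h1 := hd.mono (List.subset_append_left _ _) (List.Subset.refl _)
    have h2 := hd.mono (List.subset_append_right _ _) (List.Subset.refl _)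
    exact (ih h1).par hR.stepDet (hF.ldisj hFR h2)
  | parR hF hR hFR ih =>
    have h1 := hd.mono (List.subset_append_right _ _) (List.Subset.refl _)
    have h2 := hd.mono (List.subset_append_left _ _) (List.Subset.refl _)
    exact hR.stepDet.par (ih h1) (hF.ldisj hFR h2).symm
  | sumL hF hR hFR ih =>
    have h1 := hd.mono (List.subset_append_left _ _) (List.Subset.refl _)
    have h2 := hd.mono (List.subset_append_right _ _) (List.Subset.refl _)
    exact (ih h1).sum hR.stepDet (hF.ldisj hFR h2)
  | sumR hF hR hFR ih =>
    have h1 := hd.mono (List.subset_append_right _ _) (List.Subset.refl _)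
    have h2 := hd.mono (List.subset_append_left _ _) (List.Subset.refl _)
    exact hR.stepDet.sum (ih h1) (hF.ldisj hFR h2).symm

/-- A step of the context exists for every filling. Filling with the empty process shows that it
uses labels of the context only. -/
theorem CtxStep.guard_subset {F : Proc → Proc} {g : Guard} {α : Act} {ν : PMF (Proc → Proc)}
    (h : CtxStep F g α ν) : g.labels ⊆ (F .nil).labels := (h.1 .nil).guard_subset

theorem CtxStep.covers {F G : Proc → Proc} {g : Guard} {α : Act} {ν : PMF (Proc → Proc)}
    (h : CtxStep F g α ν) (hG : G ∈ ν.support) : Covers (F .nil).labels (G .nil).labels :=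
  (h.1 .nil).covers _ ((PMF.mem_support_map_iff _ _ _).2 ⟨G, hG, rfl⟩)

theorem CtxStep.lift {F : Proc → Proc} {g : Guard} {α : Act} {ν : PMF (Proc → Proc)}
    (h : CtxStep F g α ν) {F' : Proc → Proc} (K : (Proc → Proc) → Proc → Proc)
    (h1 : ∀ X, Step (F' X) g α (ν.map fun G => K G X)) (h2 : ∀ G ∈ ν.support, HoleCtx (K G)) :
    CtxStep F' g α (ν.map K) := by
  refine ⟨fun X => ?_, ?_, fun hα => ?_⟩
  · rw [PMF.map_comp]
    exact h1 X
  · simpa only [PMF.support_map, Set.forall_mem_image] using h2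
  · obtain ⟨G, rfl⟩ := h.2.2 hα
    exact ⟨_, PMF.pure_map _ _⟩

theorem ctxStep_of_step {R : Proc} {g : Guard} {α : Act} {μ : PMF Proc} (h : Step R g α μ)
    {F : Proc → Proc} (K : Proc → Proc → Proc)
    (h1 : ∀ X, Step (F X) g α (μ.map fun R' => K R' X)) (h2 : ∀ R' ∈ μ.support, HoleCtx (K R')) :
    CtxStep F g α (μ.map K) := by
  refine ⟨fun X => ?_, ?_, fun hα => ?_⟩
  · rw [PMF.map_comp]
    exact h1 X
  · simpa only [PMF.support_map, Set.forall_mem_image] using h2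
  · obtain ⟨R', rfl⟩ := h.eq_pure hα
    exact ⟨_, PMF.pure_map _ _⟩

/-- The transitions of `F[X]`, where `X` has one transition. -/
def CtxOrHole (F : Proc → Proc) (X : Proc) (a : Label) (χ : PMF Proc) (g : Guard) (α : Act)
    (μ : PMF Proc) : Prop :=
  (∃ ν, CtxStep F g α ν ∧ μ = ν.map fun G => G X) ∨
    (g = .one a ∧ α = .tau ∧ ∃ H, HoleStep F H ∧ μ = χ.map H)

/-- The process in the hole moves only silently, so a visible transition comes from the context.
Hence the hole never takes part in a communication. -/
theorem CtxOrHole.pure {F : Proc → Proc} {X : Proc} {a : Label} {χ : PMF Proc} {g : Guard}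
    {α : Act} {P' : Proc} (h : CtxOrHole F X a χ g α (PMF.pure P')) (hα : α ≠ .tau) :
    ∃ G, CtxStep F g α (PMF.pure G) ∧ G X = P' := by
  rcases h with ⟨ν, hν, h⟩ | ⟨-, h, -⟩
  · obtain ⟨G, rfl⟩ := hν.2.2 hα
    rw [PMF.pure_map] at h
    exact ⟨G, hν, (pure_injective h).symm⟩
  · exact absurd h hα

theorem CtxStep.pure {F G : Proc → Proc} {g : Guard} {α : Act}
    (h : CtxStep F g α (PMF.pure G)) :
    (∀ X, Step (F X) g α (PMF.pure (G X))) ∧ HoleCtx G ∧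
      Covers (F .nil).labels (G .nil).labels := by
  refine ⟨fun X => ?_, h.2.1 G (by simp), h.covers (by simp)⟩
  have := h.1 X
  rwa [PMF.pure_map] at this

theorem CtxOrHole.lift {F : Proc → Proc} {X : Proc} {a : Label} {χ : PMF Proc} {g : Guard}
    {α : Act} {μ : PMF Proc} (h : CtxOrHole F X a χ g α μ) {F' : Proc → Proc} (k : Proc → Proc)
    (h1 : ∀ Y g μ, Step (F Y) g α μ → Step (F' Y) g α (μ.map k))
    (h2 : ∀ G, HoleCtx G → Covers (F .nil).labels (G .nil).labels → HoleCtx fun Y => k (G Y)) :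
    CtxOrHole F' X a χ g α (μ.map k) := by
  rcases h with ⟨ν, hν, rfl⟩ | ⟨rfl, rfl, H, hH, rfl⟩
  · refine .inl ⟨_, hν.lift (fun G Y => k (G Y)) (fun Y => ?_) fun G hG => h2 G (hν.2.1 G hG)
      (hν.covers hG), ?_⟩
    · have := h1 Y _ _ (hν.1 Y)
      rwa [PMF.map_comp] at this
    · rw [PMF.map_comp, PMF.map_comp]
      rfl
  · refine .inr ⟨rfl, rfl, fun P' => k (H P'), fun Y b μ hY => ?_, PMF.map_comp _ _ _⟩
    have := h1 Y _ _ (hH Y b μ hY)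
    rwa [PMF.map_comp] at this

theorem LDisj.of_step {F : Proc → Proc} {R R' : Proc} {g : Guard} {α : Act} {μ : PMF Proc}
    (hd : LDisj (F .nil).labels R.labels) (h : Step R g α μ) (hR' : R' ∈ μ.support) :
    LDisj (F .nil).labels R'.labels :=
  hd.of_covers (.refl _) (h.covers R' hR')

/-- Every transition of `F[X]` is one of the context or one of the process in the hole. -/
theorem HoleCtx.step_cases {F : Proc → Proc} (hF : HoleCtx F) {X : Proc} {a : Label}
    {χ : PMF Proc} (hX : HoleProc X a χ) {g : Guard} {α : Act} {μ : PMF Proc}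
    (h : Step (F X) g α μ) : CtxOrHole F X a χ g α μ := by
  induction hF generalizing g α μ with
  | hole =>
    obtain ⟨rfl, rfl, rfl⟩ := (hX _ _ _).1 h
    refine .inr ⟨rfl, rfl, id, fun Y b μ hY => ?_, (PMF.map_id _).symm⟩
    rwa [PMF.map_id]
  | @const R hR =>
    refine .inl ⟨_, ctxStep_of_step h (fun R' _ => R') (fun _ => ?_) fun R' hR' =>
      .const (hR.of_step h hR'), ?_⟩
    · exact (PMF.map_id μ).symm ▸ h
    · rw [PMF.map_comp]
      exact (PMF.map_id μ).symm
  | pre l α hF ih =>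
    cases h with
    | act =>
      exact .inl ⟨PMF.pure _, ⟨fun X => by rw [PMF.pure_map]; exact .act _ _ _,
        by simpa using hF, fun _ => ⟨_, rfl⟩⟩, by rw [PMF.pure_map]⟩
  | @psum n l w F hF ih =>
    cases h with
    | prob =>
      refine .inl ⟨w.map F, ⟨fun X => ?_, ?_, fun h => absurd rfl h⟩, ?_⟩
      · rw [PMF.map_comp]
        exact .prob _ _ _
      · simpa only [PMF.support_map, Set.forall_mem_image] using fun i _ => hF i
      · rw [PMF.map_comp]
        rfl
  | res a hF ih =>
    cases h with
    | res h h1 h2 =>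
      exact (ih h).lift _ (fun Y g μ hs => .res hs h1 h2) fun G hG _ => hG.res a
  | @sumL F R hF hR hd ih =>
    cases h with
    -- Resolving the sum towards the hole leaves the residual unchanged, so the wrapper is the
    -- identity. Resolving it the other way discards the hole, and the new context is constant.
    | sum1 h =>
      have := (ih h).lift (F' := fun X => .sum (F X) R) id
        (fun Y g μ hs => .sum1 (by rwa [PMF.map_id])) fun G hG _ => hG
      rwa [PMF.map_id] at this
    | sum2 h =>
      refine .inl ⟨_, ctxStep_of_step h (fun R' _ => R') (fun _ => ?_) fun R' hR' =>
        .const (hR.of_step h hR'), ?_⟩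
      · exact .sum2 ((PMF.map_id μ).symm ▸ h)
      · rw [PMF.map_comp]
        exact (PMF.map_id μ).symm
  | @sumR F R hF hR hd ih =>
    cases h with
    | sum2 h =>
      have := (ih h).lift (F' := fun X => .sum R (F X)) id
        (fun Y g μ hs => .sum2 (by rwa [PMF.map_id])) fun G hG _ => hG
      rwa [PMF.map_id] at this
    | sum1 h =>
      refine .inl ⟨_, ctxStep_of_step h (fun R' _ => R') (fun _ => ?_) fun R' hR' =>
        .const (hR.of_step h hR'), ?_⟩
      · exact .sum1 ((PMF.map_id μ).symm ▸ h)
      · rw [PMF.map_comp]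
        exact (PMF.map_id μ).symm
  | @parL F R hF hR hd ih =>
    cases h with
    | par1 h =>
      exact (ih h).lift (F' := fun X => .par (F X) R) (fun P' => .par P' R)
        (fun Y g μ hs => .par1 hs) fun G hG hc => hG.parL hR (hd.of_covers hc (.refl _))
    | par2 h =>
      refine .inl ⟨_, ctxStep_of_step h (fun R' X => .par (F X) R') (fun _ => .par2 h)
        fun R' hR' => hF.parL (hR.of_step h hR') (hd.of_step h hR'), ?_⟩
      rw [PMF.map_comp]
      rfl
    | @com _ _ P' R' _ _ _ _ h h' hc =>
      obtain ⟨G, hG, rfl⟩ := (ih h).pure hc.ne_tau.1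
      obtain ⟨h1, h2, h3⟩ := hG.pure
      refine .inl ⟨PMF.pure fun X => .par (G X) R', ⟨fun X => ?_, ?_, fun _ => ⟨_, rfl⟩⟩, ?_⟩
      · rw [PMF.pure_map]
        exact .com (h1 X) h' hc
      · simp only [PMF.support_pure, Set.mem_singleton_iff, forall_eq]
        exact h2.parL (hR.of_step h' (by simp)) (hd.of_covers h3 (h'.covers R' (by simp)))
      · rw [PMF.pure_map]
  | @parR F R hF hR hd ih =>
    cases h with
    | par2 h =>
      exact (ih h).lift (F' := fun X => .par R (F X)) (fun P' => .par R P')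
        (fun Y g μ hs => .par2 hs) fun G hG hc => hG.parR hR (hd.of_covers hc (.refl _))
    | par1 h =>
      refine .inl ⟨_, ctxStep_of_step h (fun R' X => .par R' (F X)) (fun _ => .par1 h)
        fun R' hR' => hF.parR (hR.of_step h hR') (hd.of_step h hR'), ?_⟩
      rw [PMF.map_comp]
      rfl
    | @com _ _ R' P' _ _ _ _ h' h hc =>
      obtain ⟨G, hG, rfl⟩ := (ih h).pure hc.ne_tau.2
      obtain ⟨h1, h2, h3⟩ := hG.pure
      refine .inl ⟨PMF.pure fun X => .par R' (G X), ⟨fun X => ?_, ?_, fun _ => ⟨_, rfl⟩⟩, ?_⟩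
      · rw [PMF.pure_map]
        exact .com h' (h1 X) hc
      · simp only [PMF.support_pure, Set.mem_singleton_iff, forall_eq]
        exact h2.parR (hR.of_step h' (by simp)) (hd.of_covers h3 (h'.covers R' (by simp)))
      · rw [PMF.pure_map]

/-- Linearity makes sibling components disjoint and, as there is no replication, makes the
components without the hole deterministic. -/
theorem Ctx.holeCtx_fill {C : Ctx} (hb : C.BangFree) (hl : Linear C.labels) :
    HoleCtx fun X => C.fill X := by
  induction C with
  | hole => exact .hole
  | pre l α C ih => exact (ih hb hl.of_cons).pre l α
  | res a C ih => exact (ih hb hl).res a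
  | bang C => exact hb.elim
  | parL C R ih =>
    obtain ⟨h1, h2, h3⟩ := linear_append.1 hl
    exact (ih hb.1 h1).parL (stepsDet_of_linear hb.2 h2) h3
  | parR R C ih =>
    obtain ⟨h1, h2, h3⟩ := linear_append.1 hl
    exact (ih hb.2 h2).parR (stepsDet_of_linear hb.1 h1) h3.symm
  | sumL C R ih =>
    obtain ⟨h1, h2, h3⟩ := linear_append.1 hl
    exact (ih hb.1 h1).sumL (stepsDet_of_linear hb.2 h2) h3
  | sumR R C ih =>
    obtain ⟨h1, h2, h3⟩ := linear_append.1 hl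
    exact (ih hb.2 h2).sumR (stepsDet_of_linear hb.1 h1) h3.symm
  | psum l w i C P ih =>
    refine .psum l w fun j => ?_
    have h1 := hb j
    have h2 : Linear _ := hl.sublist (labels_psum_subset l w _ j)
    by_cases hj : j = i
    · simp only [hj, dite_true] at h1 h2 ⊢
      exact ih h1 h2
    · simp only [hj, dite_false] at h1 h2 ⊢
      exact .const (stepsDet_of_linear h1 h2)

theorem HoleCtx.resAll {F : Proc → Proc} (hF : HoleCtx F) (as : List Chan) :
    HoleCtx fun X => (F X).resAll as := by
  induction as with
  | nil => exact hF
  | cons a as ih => exact ih.res a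

theorem labels_resAll (as : List Chan) (P : Proc) : (P.resAll as).labels = P.labels := by
  induction as with
  | nil => rfl
  | cons a as ih => exact ih

/-! ### Exchanging the label of the process in the hole -/

open Classical in
/-- Exchange of two labels in a guard. -/
noncomputable def Guard.swap (a b : Label) : Guard → Guard
  | .one l => .one (Equiv.swap a b l)
  | .two l m => .two (Equiv.swap a b l) (Equiv.swap a b m)

theorem Guard.swap_swap (a b : Label) (g : Guard) : (g.swap a b).swap b a = g := by
  classical
  cases g <;> simp [Guard.swap, Equiv.swap_comm b a]

theorem Guard.swap_one_left (a b : Label) : Guard.swap a b (.one a) = .one b := by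
  simp [Guard.swap]

theorem Guard.swap_of_not_mem {a b : Label} {g : Guard} (ha : a ∉ g.labels) (hb : b ∉ g.labels) :
    g.swap a b = g := by
  classical
  cases g <;> simp only [Guard.labels, List.mem_cons, List.not_mem_nil, or_false, not_or] at ha hb
  · simp [Guard.swap, Equiv.swap_apply_of_ne_of_ne (Ne.symm ha) (Ne.symm hb)]
  · simp [Guard.swap, Equiv.swap_apply_of_ne_of_ne (Ne.symm ha.1) (Ne.symm hb.1),
      Equiv.swap_apply_of_ne_of_ne (Ne.symm ha.2) (Ne.symm hb.2)]

open Classical in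
/-- The scheduler that exchanges `a` and `b` in the guards until it passes a guard `σ(a)`. -/
noncomputable def swapUntil (a b : Label) : Sched → Sched :=
  Sched.unfold fun S => S.leaves.map fun y =>
    (y.1.swap a b, if y.1 = .one a then .inr y.2 else .inl y.2)

open Classical in
theorem leaves_swapUntil (a b : Label) (S : Sched) :
    (swapUntil a b S).leaves = S.leaves.map fun y =>
      (y.1.swap a b, if y.1 = .one a then y.2 else swapUntil a b y.2) := by
  rw [swapUntil, leaves_unfold, List.map_map]
  refine List.map_congr_left fun y _ => ?_
  simp only [Function.comp_apply]
  split_ifs <;> rfl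

section

variable {F : Proc → Proc} {X Y : Proc} {a b : Label} {χ χ' : PMF Proc}

/-- Guards of the context contain neither `a` nor `b` and are fixed by the exchange; the guard
`σ(a)` of the hole becomes `σ(b)`. -/
theorem HoleCtx.enabled_swap (hF : HoleCtx F) (hX : HoleProc X a χ) (hY : HoleProc Y b χ')
    (ha : a ∉ (F .nil).labels) (hb : b ∉ (F .nil).labels) {g : Guard} (h : (F X).Enabled g) :
    (F Y).Enabled (g.swap a b) := by
  obtain ⟨α, μ, h⟩ := h
  rcases hF.step_cases hX h with ⟨ν, hν, -⟩ | ⟨rfl, rfl, H, hH, -⟩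
  · rw [Guard.swap_of_not_mem (fun h => ha (hν.guard_subset h)) fun h => hb (hν.guard_subset h)]
    exact ⟨α, _, hν.1 Y⟩
  · rw [Guard.swap_one_left]
    exact ⟨.tau, _, hH Y b _ hY.step⟩

/-- The equivalence relies on an exchange rather than a replacement of labels: for `a ≠ b`, an idle
guard `σ(b)` must not become enabled, and it turns into `σ(a)`, which is idle for the new filling.
The reverse direction is the same exchange undone. -/
theorem HoleCtx.enabled_swap_iff (hF : HoleCtx F) (hX : HoleProc X a χ) (hY : HoleProc Y b χ')
    (ha : a ∉ (F .nil).labels) (hb : b ∉ (F .nil).labels) (g : Guard) :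
    (F Y).Enabled (g.swap a b) ↔ (F X).Enabled g := by
  refine ⟨fun h => ?_, hF.enabled_swap hX hY ha hb⟩
  have := hF.enabled_swap hY hX hb ha h
  rwa [Guard.swap_swap] at this

theorem HoleCtx.pick_eq (hF : HoleCtx F) (hX : HoleProc X a χ) (hY : HoleProc Y a χ')
    (ha : a ∉ (F .nil).labels) (L : List (Guard × Sched)) : (F X).pick L = (F Y).pick L := by
  have : (F X).Enabled = (F Y).Enabled := by
    funext g
    have e : g.swap a a = g := by cases g <;> simp [Guard.swap]
    have := hF.enabled_swap_iff hX hY ha ha g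
    rw [e] at this
    exact propext this.symm
  rw [Proc.pick, Proc.pick, this]

open Classical in
theorem HoleCtx.pick_swapUntil (hF : HoleCtx F) (hX : HoleProc X a χ) (hY : HoleProc Y b χ')
    (ha : a ∉ (F .nil).labels) (hb : b ∉ (F .nil).labels) (S : Sched) :
    (F Y).pick (swapUntil a b S).leaves = ((F X).pick S.leaves).map fun y =>
      (y.1.swap a b, if y.1 = .one a then y.2 else swapUntil a b y.2) := by
  rw [leaves_swapUntil, Proc.pick, Proc.pick, List.find?_map]
  congr 2
  funext y
  simp [hF.enabled_swap_iff hX hY ha hb]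

theorem CtxStep.ne_one {g : Guard} {α : Act} {ν : PMF (Proc → Proc)} (h : CtxStep F g α ν)
    (ha : a ∉ (F .nil).labels) : g ≠ .one a := by
  rintro rfl
  exact ha (h.guard_subset (List.mem_cons_self ..))

theorem HoleCtx.uniqueStep (hF : HoleCtx F) (hX : HoleProc X a χ)
    (hd : LDisj (F .nil).labels X.labels) (g : Guard) : UniqueStep (F X) g :=
  hF.stepDet hX.stepDet hd g

variable {ι κ : Type*} {π : PMF ι} {π' : PMF κ} {X : ι → Proc} {Y : κ → Proc} {χ : ι → PMF Proc}
  {χ' : κ → PMF Proc}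

/-- If two families of processes that wait for a silent step lead to the same mixture, then a
context has the same average success probability for both of them, with the label exchanged. -/
theorem expect_val_swapUntil (hX : ∀ i, HoleProc (X i) a (χ i)) (hY : ∀ j, HoleProc (Y j) b (χ' j))
    (hπ : π.bind χ = π'.bind χ') (hF : HoleCtx F) (hdX : ∀ i, LDisj (F .nil).labels (X i).labels)
    (hdY : ∀ j, LDisj (F .nil).labels (Y j).labels) (S : Sched) (n : ℕ) :
    (expect π fun i => val n (F (X i), S)) =
      expect π' fun j => val n (F (Y j), swapUntil a b S) := by
  classical
  induction n generalizing F S with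
  | zero => simp only [val, expect_const]
  | succ n ih =>
    -- The leaf that fires does not depend on the filling, so one representative of the family
    -- decides it.
    obtain ⟨i₀, -⟩ := π.support_nonempty
    obtain ⟨j₀, -⟩ := π'.support_nonempty
    have ha : a ∉ (F .nil).labels := (hdX i₀).symm.not_mem (hX i₀).mem_labels
    have hb : b ∉ (F .nil).labels := (hdY j₀).symm.not_mem (hY j₀).mem_labels
    have hpX := fun i => hF.pick_eq (hX i) (hX i₀) ha S.leaves
    have hpY := fun j => hF.pick_swapUntil (hX i₀) (hY j) ha hb S
    rcases hp : (F (X i₀)).pick S.leaves with _ | ⟨g, T⟩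
    · simp only [hp, Option.map_none] at hpX hpY
      simp only [val_of_pick_eq_none (hpX _), val_of_pick_eq_none (hpY _), expect_const]
    · simp only [hp, Option.map_some] at hpX hpY
      obtain ⟨α, μ, hs⟩ := Proc.enabled_of_pick hp
      rcases hF.step_cases (hX i₀) hs with ⟨ν, hν, -⟩ | ⟨rfl, rfl, H, hH, -⟩
      · have hg : g.swap a b = g := Guard.swap_of_not_mem (fun h => ha (hν.guard_subset h))
          fun h => hb (hν.guard_subset h)
        simp only [hg, if_neg (hν.ne_one ha)] at hpY
        simp only [val_succ_of_step (hpX _) (hν.1 _) (hF.uniqueStep (hX _) (hdX _) g),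
          val_succ_of_step (hpY _) (hν.1 _) (hF.uniqueStep (hY _) (hdY _) g)]
        split_ifs
        · simp only [expect_const]
        · simp only [expect_map]
          -- The context moves by the same `ν` for all fillings, so its move can be averaged last
          -- and induction applied to each residual context.
          rw [expect_comm, expect_comm π']
          refine expect_congr ν fun G hG => ?_
          exact ih (hν.2.1 G hG) (fun i => (hdX i).of_covers (hν.covers hG) (.refl _))
            (fun j => (hdY j).of_covers (hν.covers hG) (.refl _)) T
      · simp only [if_true, Guard.swap_one_left] at hpY
        simp only [
          val_succ_of_step (hpX _) (hH _ a _ (hX _).step) (hF.uniqueStep (hX _) (hdX _) _),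
          val_succ_of_step (hpY _) (hH _ b _ (hY _).step) (hF.uniqueStep (hY _) (hdY _) _),
          reduceCtorEq, if_false, expect_map]
        -- Once the hole has moved, both sides run the same residual context with the same
        -- scheduler, averaged over the common mixture of residuals.
        rw [← expect_bind, ← expect_bind, hπ]

/-- Non-blocking is assumed for the whole support of `π`. While the context moves, any one member
witnesses progress; after the hole moves, the residual lies in the support of the common mixture and
is therefore reached by some member. -/
theorem live_swapUntil (hX : ∀ i, HoleProc (X i) a (χ i)) (hY : ∀ j, HoleProc (Y j) b (χ' j))
    (hπ : π.bind χ = π'.bind χ') (hF : HoleCtx F) (hdX : ∀ i, LDisj (F .nil).labels (X i).labels)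
    (hdY : ∀ j, LDisj (F .nil).labels (Y j).labels) {S : Sched}
    (hl : ∀ i ∈ π.support, Live (F (X i), S)) {j : κ} (hj : j ∈ π'.support) :
    Live (F (Y j), swapUntil a b S) := by
  classical
  refine live_of_invariant (fun P S' => ∃ F S j, HoleCtx F ∧
    (∀ i, LDisj (F .nil).labels (X i).labels) ∧ (∀ j, LDisj (F .nil).labels (Y j).labels) ∧
    (∀ i ∈ π.support, Live (F (X i), S)) ∧ j ∈ π'.support ∧ P = F (Y j) ∧
    S' = swapUntil a b S) ?_ ?_ ⟨F, S, j, hF, hdX, hdY, hl, hj, rfl, rfl⟩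
  · rintro _ _ ⟨F, S, j, hF, hdX, hdY, hl, hj, rfl, rfl⟩
    obtain ⟨i, hi⟩ := π.support_nonempty
    have ha : a ∉ (F .nil).labels := (hdX i).symm.not_mem (hX i).mem_labels
    have hb : b ∉ (F .nil).labels := (hdY j).symm.not_mem (hY j).mem_labels
    rw [hF.pick_swapUntil (hX i) (hY j) ha hb, Ne, Option.map_eq_none_iff]
    refine (hl i hi).local.imp id fun h g hg => ?_
    exact h _ (hF.enabled_swap (hY j) (hX i) hb ha hg)
  · rintro _ _ ⟨F, S, j, hF, hdX, hdY, hl, hj, rfl, rfl⟩ g' T' α μ hp hs P' hP'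
    obtain ⟨i₀, -⟩ := π.support_nonempty
    have ha : a ∉ (F .nil).labels := (hdX i₀).symm.not_mem (hX i₀).mem_labels
    have hb : b ∉ (F .nil).labels := (hdY j).symm.not_mem (hY j).mem_labels
    rw [hF.pick_swapUntil (hX i₀) (hY j) ha hb, Option.map_eq_some_iff] at hp
    obtain ⟨⟨g, T⟩, hp, he⟩ := hp
    obtain ⟨rfl, rfl⟩ := Prod.mk.inj he
    simp only at hs hP' ⊢
    have hpX := fun i => (hF.pick_eq (hX i) (hX i₀) ha S.leaves).trans hp
    rcases hF.step_cases (hY j) hs with ⟨ν, hν, rfl⟩ | ⟨hg, rfl, H, hH, rfl⟩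
    · obtain ⟨G, hG, rfl⟩ := (PMF.mem_support_map_iff _ _ _).1 hP'
      have hg : g.swap a b = g := by
        have h1 := Guard.swap_of_not_mem (fun h => hb (hν.guard_subset h))
          fun h => ha (hν.guard_subset h)
        rw [Guard.swap_swap] at h1
        exact h1.symm
      rw [hg] at hν
      rw [if_neg (hν.ne_one ha)]
      refine .inl ⟨G, T, j, hν.2.1 G hG, fun i => (hdX i).of_covers (hν.covers hG) (.refl _),
        fun j => (hdY j).of_covers (hν.covers hG) (.refl _), fun i hi => ?_, hj, rfl, rfl⟩
      exact (hl i hi).of_step (hpX i) (hν.1 (X i))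
        ((PMF.mem_support_map_iff _ _ _).2 ⟨G, hG, rfl⟩)
    · obtain rfl : g = .one a := by
        rw [← Guard.swap_swap a b g, hg, Guard.swap_one_left]
      rw [if_pos rfl]
      obtain ⟨R, hR, rfl⟩ := (PMF.mem_support_map_iff _ _ _).1 hP'
      have hR' : R ∈ (π.bind χ).support := by
        rw [hπ]
        exact (PMF.mem_support_bind_iff _ _ _).2 ⟨j, hj, hR⟩
      obtain ⟨i, hi, hR'⟩ := (PMF.mem_support_bind_iff _ _ _).1 hR'
      exact .inr ((hl i hi).of_step (hpX i) (hH _ a _ (hX i).step)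
        ((PMF.mem_support_map_iff _ _ _).2 ⟨R, hR', rfl⟩))

end

/-! ### Postponing the internal choice -/

open Classical in
/-- Replaces the leaves `σ(l).T` by the leaves of the scheduler that runs after a postponed
choice, and keeps, up to the first such leaf, those with guards made from labels in `ls`. -/
noncomputable def postponeLeaves {X : Type} (l l₁ : Label) (ls : List Label) (f : Sched → X)
    (k : Sched → X) : List (Guard × Sched) → List (Guard × X)
  | [] => []
  | y :: L =>
    if y.1 = .one l then (swapUntil l₁ l y.2).leaves.map fun z => (z.1, k z.2)
    else if Covers ls y.1.labels then (y.1, f y.2) :: postponeLeaves l l₁ ls f k L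
    else postponeLeaves l l₁ ls f k L

/-- The scheduler that, instead of resolving the choice `l`, goes on as if it had been resolved,
and uses `l` in place of `l₁`. -/
noncomputable def postpone (l l₁ : Label) (ls : List Label) : Sched → Sched :=
  Sched.unfold fun S => postponeLeaves l l₁ ls .inl .inr S.leaves

theorem map_postponeLeaves {X Y : Type} (l l₁ : Label) (ls : List Label) (f k : Sched → X)
    (h : X → Y) (L : List (Guard × Sched)) :
    (postponeLeaves l l₁ ls f k L).map (fun y => (y.1, h y.2)) =
      postponeLeaves l l₁ ls (fun S => h (f S)) (fun S => h (k S)) L := by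
  induction L with
  | nil => rfl
  | cons y L ih =>
    simp only [postponeLeaves]
    split_ifs
    · rw [List.map_map]
      rfl
    · rw [List.map_cons, ih]
    · exact ih

theorem leaves_postpone (l l₁ : Label) (ls : List Label) (S : Sched) :
    (postpone l l₁ ls S).leaves = postponeLeaves l l₁ ls (postpone l l₁ ls) id S.leaves := by
  rw [postpone, leaves_unfold, map_postponeLeaves]
  rfl

open Classical in
-- The guard `σ(l)` is always enabled in `A`, so it ends the search there and later leaves can be
-- discarded. In its place stand the leaves of the next scheduler, since `B` makes no step at this
-- point. Guards not made from `ls` are dropped: they are idle in `A` unless equal to `σ(l)`, but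
-- `B` may enable them.
theorem pick_postponeLeaves {l l₁ : Label} {ls : List Label} {A B : Proc}
    (h1 : A.Enabled (.one l)) (h2 : ∀ g, A.Enabled g → g = .one l ∨ Covers ls g.labels)
    (h3 : ∀ g, Covers ls g.labels → (A.Enabled g ↔ B.Enabled g)) (f : Sched → Sched)
    (L : List (Guard × Sched)) :
    B.pick (postponeLeaves l l₁ ls f id L) = (A.pick L).bind fun y =>
      if y.1 = .one l then B.pick (swapUntil l₁ l y.2).leaves else some (y.1, f y.2) := by
  induction L with
  | nil => rfl
  | cons y L ih =>
    simp only [postponeLeaves]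
    split_ifs with hy hc
    · have : A.pick (y :: L) = some y := by simp [Proc.pick, hy, h1]
      simp [this, hy]
    · by_cases hA : A.Enabled y.1
      · have e1 : A.pick (y :: L) = some y := by simp [Proc.pick, hA]
        have hB := (h3 _ hc).1 hA
        rw [e1, Option.bind_some, if_neg hy]
        simp [Proc.pick, hB]
      · have e1 : A.pick (y :: L) = A.pick L := by simp [Proc.pick, hA]
        have hB : ¬ B.Enabled y.1 := fun h => hA ((h3 _ hc).2 h)
        rw [e1, ← ih]
        simp [Proc.pick, hB]
    · have hA : ¬ A.Enabled y.1 := fun h => (h2 _ h).elim hy hc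
      have e1 : A.pick (y :: L) = A.pick L := by simp [Proc.pick, hA]
      rw [e1, ih]

/-- `Y` in parallel with `R`, with the channels in `as` restricted. -/
def beside (as : List Chan) (R Y : Proc) : Proc := (Proc.par Y R).resAll as

theorem HoleCtx.beside {F : Proc → Proc} (hF : HoleCtx F) (as : List Chan) {R : Proc}
    (hR : StepsDet R) (hd : LDisj (F .nil).labels R.labels) :
    HoleCtx fun X => beside as R (F X) := (hF.parL hR hd).resAll as

theorem labels_beside (as : List Chan) (R Y : Proc) :
    (beside as R Y).labels = Y.labels ++ R.labels := labels_resAll _ _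

/-- A guard made from test labels cannot involve `Y`, neither alone nor in a communication. The step
is therefore one of `R`, available beside any process. -/
theorem step_beside {as : List Chan} {R Y : Proc} {g : Guard} {α : Act} {μ : PMF Proc}
    {ls : List Label} (hg : Covers ls g.labels) (hd : LDisj ls Y.labels)
    (h : Step (beside as R Y) g α μ) :
    ∃ ν, Step R g α ν ∧ μ = (ν.map fun R' => beside as R' Y) ∧
      ∀ Z, Step (beside as R Z) g α (ν.map fun R' => beside as R' Z) := by
  have hno : ∀ M ∈ g.labels, M ∉ Y.labels := fun M hM =>
    (hd.of_covers hg (.refl _)).not_mem hM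
  obtain ⟨h1, μ', h2, rfl⟩ := step_resAll_iff.1 h
  cases h2 with
  | par1 h2 =>
    cases g <;>
      exact (hno _ (List.mem_cons_self ..) (h2.guard_subset (List.mem_cons_self ..))).elim
  | com h2 =>
    exact (hno _ (List.mem_cons_self ..) (h2.guard_subset (List.mem_cons_self ..))).elim
  | @par2 _ _ _ _ ν h2 =>
    refine ⟨ν, h2, by rw [PMF.map_comp]; rfl, fun Z => ?_⟩
    exact step_resAll_iff.2 ⟨h1, _, .par2 h2, by rw [PMF.map_comp]; rfl⟩

/-! ### The outer and the inner choice beside a test. -/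

section

variable {m : ℕ} {w : PMF (Fin m)} {P : Fin m → Proc} {F : Proc → Proc} {l l₁ : Label}
  {ls : List Label}

/-- The assumptions on labels: those of the context, of the processes in its hole, and of the
test `ls` are disjoint from each other. -/
structure Separated (w : PMF (Fin m)) (P : Fin m → Proc) (F : Proc → Proc) (l l₁ : Label)
    (ls : List Label) : Prop where
  ctx : HoleCtx F
  ctx_pre : ∀ i, LDisj (F .nil).labels (Proc.pre l₁ .tau (P i)).labels
  ctx_psum : LDisj (F .nil).labels (Proc.psum l w P).labels
  test_ctx : LDisj ls (F .nil).labels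
  test_pre : ∀ i, LDisj ls (Proc.pre l₁ .tau (P i)).labels
  test_psum : LDisj ls (Proc.psum l w P).labels

/-- The choice is resolved before the context is entered. -/
def outer (w : PMF (Fin m)) (P : Fin m → Proc) (F : Proc → Proc) (l l₁ : Label) : Proc :=
  .psum l w fun i => F (.pre l₁ .tau (P i))

/-- The choice is resolved inside the context. -/
def inner (w : PMF (Fin m)) (P : Fin m → Proc) (F : Proc → Proc) (l : Label) : Proc :=
  F (.psum l w P)

namespace Separated

theorem test_inner (h : Separated w P F l l₁ ls) : LDisj ls (inner w P F l).labels :=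
  (h.ctx.ldisj h.test_ctx.symm h.test_psum).symm

theorem test_outer (h : Separated w P F l l₁ ls) : LDisj ls (outer w P F l l₁).labels := by
  intro L hL M hM
  simp only [outer, Proc.labels, List.mem_cons, List.mem_flatten, List.mem_ofFn] at hM
  rcases hM with rfl | ⟨_, ⟨i, rfl⟩, hM⟩
  · exact h.test_psum L hL M (by simp [Proc.labels])
  · exact (h.ctx.ldisj h.test_ctx.symm (h.test_pre i)).symm L hL M hM

end Separated

variable {as : List Chan} {R : Proc}

theorem holeCtx_beside (hR : StepsDet R) : HoleCtx (beside as R) :=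
  HoleCtx.hole.beside as hR (by simp [LDisj, Proc.labels])

theorem ldisj_beside_nil {X : Proc} (hc : Covers ls R.labels) (hd : LDisj ls X.labels) :
    LDisj (beside as R .nil).labels X.labels := by
  rw [labels_beside]
  exact hd.of_covers hc (.refl _)

theorem ldisj_beside_ctx {X : Proc} (hc : Covers ls R.labels) (hd : LDisj ls X.labels)
    (hF : LDisj (F .nil).labels X.labels) : LDisj (beside as R (F .nil)).labels X.labels := by
  rw [labels_beside]
  intro L hL
  rcases List.mem_append.1 hL with hL | hL
  · exact hF L hL
  · exact hd.of_covers hc (.refl _) L hL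

theorem holeProc_outer (w : PMF (Fin m)) (P : Fin m → Proc) (F : Proc → Proc) (l l₁ : Label) :
    HoleProc (outer w P F l l₁) l (w.map fun i => F (.pre l₁ .tau (P i))) :=
  holeProc_psum _ _ _

theorem step_beside_outer (w : PMF (Fin m)) (P : Fin m → Proc) (F : Proc → Proc) (l l₁ : Label)
    (as : List Chan) (R : Proc) :
    Step (beside as R (outer w P F l l₁)) (.one l) .tau
      (w.map fun i => beside as R (F (.pre l₁ .tau (P i)))) := by
  refine step_resAll_iff.2 ⟨fun a _ => by simp, _, .par1 (holeProc_outer w P F l l₁).step, ?_⟩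
  rw [PMF.map_comp, PMF.map_comp]
  rfl

namespace Separated

theorem uniqueStep_outer (h : Separated w P F l l₁ ls) (hR : StepsDet R)
    (hc : Covers ls R.labels) (g : Guard) : UniqueStep (beside as R (outer w P F l l₁)) g :=
  (holeCtx_beside hR).uniqueStep (holeProc_outer w P F l l₁)
    (ldisj_beside_nil hc h.test_outer) g

theorem enabled_outer (hR : StepsDet R) (hc : Covers ls R.labels) {g : Guard}
    (hg : (beside as R (outer w P F l l₁)).Enabled g) : g = .one l ∨ Covers ls g.labels := by
  obtain ⟨α, μ, hg⟩ := hg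
  rcases (holeCtx_beside hR).step_cases (holeProc_outer w P F l l₁) hg with ⟨ν, hν, -⟩ | ⟨rfl, -⟩
  · refine .inr (hc.trans (.of_subset ?_))
    simpa [labels_beside, Proc.labels] using hν.guard_subset
  · exact .inl rfl

theorem enabled_iff (h : Separated w P F l l₁ ls) {g : Guard} (hg : Covers ls g.labels) :
    (beside as R (outer w P F l l₁)).Enabled g ↔ (beside as R (inner w P F l)).Enabled g := by
  constructor
  · rintro ⟨α, μ, hs⟩
    obtain ⟨ν, -, -, hν⟩ := step_beside hg h.test_outer hs
    exact ⟨α, _, hν _⟩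
  · rintro ⟨α, μ, hs⟩
    obtain ⟨ν, -, -, hν⟩ := step_beside hg h.test_inner hs
    exact ⟨α, _, hν _⟩

theorem covers_of_step {R R' : Proc} {g : Guard} {α : Act} {ν : PMF Proc}
    (hc : Covers ls R.labels) (hs : Step R g α ν) (hR' : R' ∈ ν.support) : Covers ls R'.labels :=
  hc.trans (hs.covers R' hR')

open Classical in
theorem pick_postpone (h : Separated w P F l l₁ ls) (hR : StepsDet R) (hc : Covers ls R.labels)
    (S : Sched) :
    (beside as R (inner w P F l)).pick (postpone l l₁ ls S).leaves =
      ((beside as R (outer w P F l l₁)).pick S.leaves).bind fun y =>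
        if y.1 = .one l then (beside as R (inner w P F l)).pick (swapUntil l₁ l y.2).leaves
        else some (y.1, postpone l l₁ ls y.2) := by
  rw [leaves_postpone]
  exact pick_postponeLeaves ⟨_, _, step_beside_outer w P F l l₁ as R⟩
    (fun g hg => enabled_outer hR hc hg) (fun g hg => h.enabled_iff hg) _ _

theorem uniqueStep_inner (h : Separated w P F l l₁ ls) (hR : StepsDet R) {g : Guard}
    (hg : Covers ls g.labels) : UniqueStep (beside as R (inner w P F l)) g := by
  intro α β μ ν h1 h2
  obtain ⟨μ', h3, rfl, -⟩ := step_beside hg h.test_inner h1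
  obtain ⟨ν', h4, rfl, -⟩ := step_beside hg h.test_inner h2
  obtain ⟨rfl, rfl⟩ := hR.stepDet g _ _ _ _ h3 h4
  exact ⟨rfl, rfl⟩

theorem expect_val_pre (h : Separated w P F l l₁ ls) (hR : StepsDet R) (hc : Covers ls R.labels)
    (S : Sched) (n : ℕ) :
    (expect w fun i => val n (beside as R (F (.pre l₁ .tau (P i))), S)) =
      val n (beside as R (inner w P F l), swapUntil l₁ l S) := by
  -- The inner choice is viewed as a family with one member, whose step leads to `w.map P`, the
  -- mixture of the continuations of the prefixes.
  have := expect_val_swapUntil (F := fun X => beside as R (F X)) (π := w) (π' := PMF.pure ())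
    (fun i => holeProc_pre l₁ (P i)) (fun _ => holeProc_psum l w P)
    (by rw [PMF.pure_bind]; rfl)
    (h.ctx.beside as hR (h.test_ctx.symm.of_covers (.refl _) hc))
    (fun i => ldisj_beside_ctx hc (h.test_pre i) (h.ctx_pre i))
    (fun _ => ldisj_beside_ctx hc h.test_psum h.ctx_psum) S n
  rwa [expect_pure] at this

theorem val_inner (h : Separated w P F l l₁ ls) (hR : StepsDet R) (hc : Covers ls R.labels)
    (S : Sched) (n : ℕ) :
    val n (beside as R (inner w P F l), S) =
      expect w fun i => val n (beside as R (F (.pre l₁ .tau (P i))), swapUntil l l₁ S) := by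
  have := expect_val_swapUntil (F := fun X => beside as R (F X)) (π := PMF.pure ()) (π' := w)
    (fun _ => holeProc_psum l w P) (fun i => holeProc_pre l₁ (P i))
    (by rw [PMF.pure_bind]; rfl)
    (h.ctx.beside as hR (h.test_ctx.symm.of_covers (.refl _) hc))
    (fun _ => ldisj_beside_ctx hc h.test_psum h.ctx_psum)
    (fun i => ldisj_beside_ctx hc (h.test_pre i) (h.ctx_pre i)) S n
  rwa [expect_pure] at this

theorem live_inner_of_pre (h : Separated w P F l l₁ ls) (hR : StepsDet R)
    (hc : Covers ls R.labels) {S : Sched}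
    (hl : ∀ i ∈ w.support, Live (beside as R (F (.pre l₁ .tau (P i))), S)) :
    Live (beside as R (inner w P F l), swapUntil l₁ l S) :=
  live_swapUntil (F := fun X => beside as R (F X)) (π := w) (π' := PMF.pure ())
    (fun i => holeProc_pre l₁ (P i)) (fun _ => holeProc_psum l w P)
    (by rw [PMF.pure_bind]; rfl)
    (h.ctx.beside as hR (h.test_ctx.symm.of_covers (.refl _) hc))
    (fun i => ldisj_beside_ctx hc (h.test_pre i) (h.ctx_pre i))
    (fun _ => ldisj_beside_ctx hc h.test_psum h.ctx_psum) hl (j := ()) (by simp)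

theorem live_pre_of_inner (h : Separated w P F l l₁ ls) (hR : StepsDet R)
    (hc : Covers ls R.labels) {S : Sched} (hl : Live (beside as R (inner w P F l), S))
    {i : Fin m} (hi : i ∈ w.support) :
    Live (beside as R (F (.pre l₁ .tau (P i))), swapUntil l l₁ S) :=
  live_swapUntil (F := fun X => beside as R (F X)) (π := PMF.pure ()) (π' := w)
    (fun _ => holeProc_psum l w P) (fun i => holeProc_pre l₁ (P i))
    (by rw [PMF.pure_bind]; rfl)
    (h.ctx.beside as hR (h.test_ctx.symm.of_covers (.refl _) hc))
    (fun _ => ldisj_beside_ctx hc h.test_psum h.ctx_psum)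
    (fun i => ldisj_beside_ctx hc (h.test_pre i) (h.ctx_pre i)) (fun _ _ => hl) hi

theorem val_outer_of_pick (h : Separated w P F l l₁ ls) (hR : StepsDet R)
    (hc : Covers ls R.labels) {S T : Sched}
    (hp : (beside as R (outer w P F l l₁)).pick S.leaves = some (.one l, T)) (n : ℕ) :
    val (n + 1) (beside as R (outer w P F l l₁), S) =
      expect w fun i => val n (beside as R (F (.pre l₁ .tau (P i))), T) := by
  rw [val_succ_of_step hp (step_beside_outer w P F l l₁ as R) (h.uniqueStep_outer hR hc _),
    if_neg (by simp), expect_map]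

/-- The extra step on the right is the resolution of the outer choice, which the postponing
scheduler skips. -/
theorem val_postpone_of_choice (h : Separated w P F l l₁ ls) (hR : StepsDet R)
    (hc : Covers ls R.labels) {S T : Sched}
    (hp : (beside as R (outer w P F l l₁)).pick S.leaves = some (.one l, T)) (n : ℕ) :
    val n (beside as R (inner w P F l), postpone l l₁ ls S) =
      val (n + 1) (beside as R (outer w P F l l₁), S) := by
  rw [h.val_outer_of_pick hR hc hp, h.expect_val_pre hR hc]
  refine val_congr ?_ n
  rw [h.pick_postpone hR hc, hp, Option.bind_some, if_pos rfl]

/-- A transition by a guard other than `σ(l)` is a transition of the test. -/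
theorem test_step (h : Separated w P F l l₁ ls) (hR : StepsDet R) (hc : Covers ls R.labels)
    {S T : Sched} {g : Guard}
    (hp : (beside as R (outer w P F l l₁)).pick S.leaves = some (g, T)) (hg : g ≠ .one l) :
    Covers ls g.labels ∧ (beside as R (inner w P F l)).pick (postpone l l₁ ls S).leaves =
        some (g, postpone l l₁ ls T) ∧
      ∃ α ν, Step R g α ν ∧ ∀ Z, Step (beside as R Z) g α (ν.map fun R' => beside as R' Z) := by
  have hc' := (enabled_outer hR hc (Proc.enabled_of_pick hp)).resolve_left hg
  refine ⟨hc', ?_, ?_⟩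
  · rw [h.pick_postpone hR hc, hp, Option.bind_some, if_neg hg]
  · obtain ⟨α, μ, hs⟩ := Proc.enabled_of_pick hp
    obtain ⟨ν, hν, -, hν'⟩ := step_beside hc' h.test_outer hs
    exact ⟨α, ν, hν, hν'⟩

theorem val_outer_le (h : Separated w P F l l₁ ls) (hR : StepsDet R) (hc : Covers ls R.labels)
    (S : Sched) (n : ℕ) :
    val n (beside as R (outer w P F l l₁), S) ≤
      val n (beside as R (inner w P F l), postpone l l₁ ls S) := by
  induction n generalizing R S with
  | zero => exact le_rfl
  | succ n ih =>
    rcases hp : (beside as R (outer w P F l l₁)).pick S.leaves with _ | ⟨g, T⟩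
    · rw [val_of_pick_eq_none hp]
      exact zero_le
    · by_cases hg : g = .one l
      · subst hg
        rw [← h.val_postpone_of_choice hR hc hp]
        exact val_mono _ n.le_succ
      · obtain ⟨hc', hp', α, ν, hν, hs⟩ := h.test_step hR hc hp hg
        rw [val_succ_of_step hp (hs _) (h.uniqueStep_outer hR hc g),
          val_succ_of_step hp' (hs _) (h.uniqueStep_inner hR hc'), expect_map, expect_map]
        split_ifs
        · exact le_rfl
        · exact expect_mono ν fun R' hR' =>
            ih (hR.of_step hν hR') (covers_of_step hc hν hR') T

/-- Together with `val_outer_le` this encloses the postponed run between `n` and `n + 1` steps of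
the original one, so the suprema agree. If `l` never fires, both runs consist of the same moves of
the test. -/
theorem val_postpone_le (h : Separated w P F l l₁ ls) (hR : StepsDet R) (hc : Covers ls R.labels)
    (S : Sched) (n : ℕ) :
    val n (beside as R (inner w P F l), postpone l l₁ ls S) ≤
      val (n + 1) (beside as R (outer w P F l l₁), S) := by
  induction n generalizing R S with
  | zero => exact zero_le
  | succ n ih =>
    rcases hp : (beside as R (outer w P F l l₁)).pick S.leaves with _ | ⟨g, T⟩
    · rw [val_of_pick_eq_none (S := postpone l l₁ ls S)]
      · exact zero_le
      · rw [h.pick_postpone hR hc, hp]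
        rfl
    · by_cases hg : g = .one l
      · subst hg
        exact (h.val_postpone_of_choice hR hc hp _).le
      · obtain ⟨hc', hp', α, ν, hν, hs⟩ := h.test_step hR hc hp hg
        rw [val_succ_of_step hp (hs _) (h.uniqueStep_outer hR hc g),
          val_succ_of_step hp' (hs _) (h.uniqueStep_inner hR hc'), expect_map, expect_map]
        split_ifs
        · exact le_rfl
        · exact expect_mono ν fun R' hR' =>
            ih (hR.of_step hν hR') (covers_of_step hc hν hR') T

theorem live_choice (h : Separated w P F l l₁ ls) (hR : StepsDet R) (hc : Covers ls R.labels)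
    {S T : Sched} (hl : Live (beside as R (outer w P F l l₁), S))
    (hp : (beside as R (outer w P F l l₁)).pick S.leaves = some (.one l, T)) :
    Live (beside as R (inner w P F l), swapUntil l₁ l T) :=
  h.live_inner_of_pre hR hc fun i hi =>
    hl.of_step hp (step_beside_outer w P F l l₁ as R)
      ((PMF.mem_support_map_iff _ _ _).2 ⟨i, hi, rfl⟩)

theorem live_postpone (h : Separated w P F l l₁ ls) (hR : StepsDet R) (hc : Covers ls R.labels)
    {S : Sched} (hl : Live (beside as R (outer w P F l l₁), S)) :
    Live (beside as R (inner w P F l), postpone l l₁ ls S) := by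
  refine live_of_invariant (fun B S' => ∃ R S, StepsDet R ∧ Covers ls R.labels ∧
    Live (beside as R (outer w P F l l₁), S) ∧ B = beside as R (inner w P F l) ∧
      S' = postpone l l₁ ls S) ?_ ?_ ⟨R, S, hR, hc, hl, rfl, rfl⟩
  · rintro _ _ ⟨R, S, hR, hc, hl, rfl, rfl⟩
    rcases hp : (beside as R (outer w P F l l₁)).pick S.leaves with _ | ⟨g, T⟩
    -- The outer choice can always fire `l`, so a non-blocking scheduler must pick some leaf here.
    · exact (hl.local.elim (fun h => h hp)
        fun h => h _ ⟨_, _, step_beside_outer w P F l l₁ as R⟩).elim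
    · by_cases hg : g = .one l
      · subst hg
        rw [h.pick_postpone hR hc, hp, Option.bind_some, if_pos rfl]
        exact (h.live_choice hR hc hl hp).local
      · rw [(h.test_step hR hc hp hg).2.1]
        exact .inl (by simp)
  · rintro _ _ ⟨R, S, hR, hc, hl, rfl, rfl⟩ g' T' β μ hp' hs P' hP'
    rcases hp : (beside as R (outer w P F l l₁)).pick S.leaves with _ | ⟨g, T⟩
    · rw [h.pick_postpone hR hc, hp] at hp'
      cases hp'
    · by_cases hg : g = .one l
      · subst hg
        rw [h.pick_postpone hR hc, hp, Option.bind_some, if_pos rfl] at hp'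
        exact .inr ((h.live_choice hR hc hl hp).of_step hp' hs hP')
      · obtain ⟨hc', hp₁, α, ν, hν, hs'⟩ := h.test_step hR hc hp hg
        obtain ⟨rfl, rfl⟩ := Prod.mk.inj (Option.some.inj (hp₁.symm.trans hp'))
        obtain ⟨rfl, rfl⟩ := h.uniqueStep_inner hR hc' _ _ _ _ hs (hs' _)
        obtain ⟨R', hR', rfl⟩ := (PMF.mem_support_map_iff _ _ _).1 hP'
        exact .inl ⟨R', T, hR.of_step hν hR', covers_of_step hc hν hR',
          hl.of_step hp (hs' _) ((PMF.mem_support_map_iff _ _ _).2 ⟨R', hR', rfl⟩), rfl, rfl⟩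

/-- Schedulers of the outer choice can be matched by schedulers of the inner one. -/
theorem exists_sched_inner (h : Separated w P F l l₁ ls) (hR : StepsDet R)
    (hc : Covers ls R.labels) {S : Sched} (hl : Live (beside as R (outer w P F l l₁), S)) :
    ∃ T, Live (beside as R (inner w P F l), T) ∧
      ⨆ n, val n (beside as R (outer w P F l l₁), S) =
        ⨆ n, val n (beside as R (inner w P F l), T) := by
  refine ⟨_, h.live_postpone hR hc hl, le_antisymm ?_ ?_⟩
  · exact iSup_mono fun n => h.val_outer_le hR hc S n
  · exact iSup_le fun n => le_iSup_of_le (n + 1) (h.val_postpone_le hR hc S n)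

/-- Schedulers of the inner choice can be matched by schedulers of the outer one. -/
theorem exists_sched_outer (h : Separated w P F l l₁ ls) (hR : StepsDet R)
    (hc : Covers ls R.labels) {T : Sched} (hl : Live (beside as R (inner w P F l), T)) :
    ∃ S, Live (beside as R (outer w P F l l₁), S) ∧
      ⨆ n, val n (beside as R (outer w P F l l₁), S) =
        ⨆ n, val n (beside as R (inner w P F l), T) := by
  classical
  -- The outer choice is resolved immediately. All summands then run under the same exchanged
  -- scheduler, which suffices because `T` does not see the summand before the hole moves.
  obtain ⟨S, hS⟩ := exists_sched_leaves_eq [(Guard.one l, swapUntil l l₁ T)]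
  have hen : (beside as R (outer w P F l l₁)).Enabled (.one l) :=
    ⟨_, _, step_beside_outer w P F l l₁ as R⟩
  have hp : (beside as R (outer w P F l l₁)).pick S.leaves =
      some (.one l, swapUntil l l₁ T) := by
    simp [hS, Proc.pick, hen]
  have hv : ∀ n, val (n + 1) (beside as R (outer w P F l l₁), S) =
      val n (beside as R (inner w P F l), T) := fun n => by
    rw [h.val_outer_of_pick hR hc hp, ← h.val_inner hR hc]
  refine ⟨S, ?_, le_antisymm (iSup_le fun n => ?_) (iSup_le fun n => ?_)⟩
  · refine live_of_invariant (fun B S' => B = beside as R (outer w P F l l₁) ∧ S' = S) ?_ ?_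
      ⟨rfl, rfl⟩
    · rintro _ _ ⟨rfl, rfl⟩
      exact .inl (by simp [hp])
    · rintro _ _ ⟨rfl, rfl⟩ g T' α μ hp' hs P' hP'
      obtain ⟨rfl, rfl⟩ := Prod.mk.inj (Option.some.inj (hp.symm.trans hp'))
      obtain ⟨rfl, rfl⟩ := h.uniqueStep_outer hR hc _ _ _ _ _ hs
        (step_beside_outer w P F l l₁ as R)
      obtain ⟨i, hi, rfl⟩ := (PMF.mem_support_map_iff _ _ _).1 hP'
      exact .inr (h.live_pre_of_inner hR hc hl hi)
  · exact le_iSup_of_le n ((val_mono _ n.le_succ).trans (hv n).le)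
  · exact le_iSup_of_le (n + 1) (hv n).ge

end Separated

end

/-! ### Testing equivalence -/

theorem Ctx.mem_labels_fill (C : Ctx) (X : Proc) (M : Label) :
    M ∈ (C.fill X).labels ↔ M ∈ (C.fill .nil).labels ∨ M ∈ X.labels := by
  induction C with
  | hole => simp [Ctx.fill, Proc.labels]
  | pre l α C ih | res a C ih | bang C ih => simp [Ctx.fill, Proc.labels, ih, or_assoc]
  | parL C R ih | parR R C ih | sumL C R ih | sumR R C ih =>
    simp only [Ctx.fill, Proc.labels, List.mem_append, ih]
    tauto
  | psum l w i C P ih =>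
    simp only [Ctx.fill, Proc.labels, List.mem_cons, List.mem_flatten, List.mem_ofFn,
      exists_exists_eq_and, or_assoc]
    refine or_congr_right ⟨?_, ?_⟩
    · rintro ⟨j, hj⟩
      by_cases h : j = i
      · simp only [h, dite_true, ih] at hj
        exact hj.imp (fun hj => ⟨i, by simpa using hj⟩) id
      · exact .inl ⟨j, by simpa [h] using hj⟩
    · rintro (⟨j, hj⟩ | hj)
      · refine ⟨j, ?_⟩
        by_cases h : j = i
        · simp only [h, dite_true, ih] at hj ⊢
          exact .inl (by simpa [Proc.labels] using hj)
        · simpa [h] using hj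
      · exact ⟨i, by simp [ih, hj]⟩

theorem Ctx.mem_actions_fill (C : Ctx) (X : Proc) (α : Act) :
    α ∈ (C.fill X).actions ↔ α ∈ (C.fill .nil).actions ∨ α ∈ X.actions := by
  induction C with
  | hole => simp [Ctx.fill, Proc.actions]
  | pre l β C ih | res a C ih | bang C ih => simp [Ctx.fill, Proc.actions, ih, or_assoc]
  | parL C R ih | parR R C ih | sumL C R ih | sumR R C ih =>
    simp only [Ctx.fill, Proc.actions, List.mem_append, ih]
    tauto
  | psum l w i C P ih =>
    simp only [Ctx.fill, Proc.actions, List.mem_flatten, List.mem_ofFn,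
      exists_exists_eq_and]
    refine ⟨?_, ?_⟩
    · rintro ⟨j, hj⟩
      by_cases h : j = i
      · simp only [h, dite_true, ih] at hj
        exact hj.imp (fun hj => ⟨i, by simpa using hj⟩) id
      · exact .inl ⟨j, by simpa [h] using hj⟩
    · rintro (⟨j, hj⟩ | hj)
      · refine ⟨j, ?_⟩
        by_cases h : j = i
        · simp only [h, dite_true, ih] at hj ⊢
          exact .inl (by simpa [Proc.actions] using hj)
        · simpa [h] using hj
      · exact ⟨i, by simp [ih, hj]⟩

/-- The channels of a process. -/
def Proc.chans (P : Proc) : List Chan := P.actions.filterMap Act.chan?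

section

variable {m : ℕ} {w : PMF (Fin m)} {P : Fin m → Proc} {C : Ctx} {l l₁ : Label} {O : Proc}

/-- The prefixes differ only in copies of the context and in added `τ`s, which have no channel. Some
summand exists because `w` is a distribution, so the channels of the context do occur in the outer
choice. -/
theorem mem_chans_outer_iff (a : Chan) :
    a ∈ (Proc.par (outer w P (fun X => C.fill X) l l₁) O).chans ↔
      a ∈ (Proc.par (inner w P (fun X => C.fill X) l) O).chans := by
  obtain ⟨i₀, -⟩ := w.support_nonempty
  have h : ∀ α : Act, α ≠ .tau → (α ∈ (outer w P (fun X => C.fill X) l l₁).actions ↔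
      α ∈ (inner w P (fun X => C.fill X) l).actions) := by
    intro α hα
    simp only [outer, inner, Proc.actions, List.mem_flatten, List.mem_ofFn,
      exists_exists_eq_and, C.mem_actions_fill (.pre _ _ _), C.mem_actions_fill (.psum _ _ _),
      List.mem_cons, hα, false_or]
    constructor
    · rintro ⟨i, hi⟩
      exact hi.imp id fun hi => ⟨i, hi⟩
    · rintro (h | ⟨i, hi⟩)
      · exact ⟨i₀, .inl h⟩
      · exact ⟨i, .inr hi⟩
  simp only [Proc.chans, Proc.actions, List.mem_filterMap, List.mem_append]
  refine exists_congr fun α => and_congr_left fun hα => ?_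
  rw [h α]
  rintro rfl
  cases hα

/-- Freshness of the test for the inner choice separates it from the context and the probabilistic
sum; freshness for the outer choice separates it from the prefixed summands. -/
theorem Separated.of_isTest
    (hctx : HoleCtx fun X => C.fill X)
    (hpre : ∀ i, LDisj C.labels (Proc.pre l₁ .tau (P i)).labels)
    (hpsum : LDisj C.labels (Proc.psum l w P).labels)
    (hO : IsTest {outer w P (fun X => C.fill X) l l₁, inner w P (fun X => C.fill X) l} O) :
    Separated w P (fun X => C.fill X) l l₁ O.labels where
  ctx := hctx
  ctx_pre := hpre
  ctx_psum := hpsum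
  test_ctx L hL M hM := hO.2.1.2 L hL _ (.inr rfl) M ((C.mem_labels_fill _ _).2 (.inl hM))
  test_psum L hL M hM := hO.2.1.2 L hL _ (.inr rfl) M ((C.mem_labels_fill _ _).2 (.inr hM))
  test_pre i L hL M hM := hO.2.1.2 L hL _ (.inl rfl) M
    ((labels_psum_subset l w _ i).subset ((C.mem_labels_fill _ _).2 (.inr hM)))

/-- Every non-blocking scheduler for one process is matched by one for the other process, with
the same success probability. -/
def Matches (A B O : Proc) : Prop :=
  ∀ S ∈ Syn (Proc.par A O).hide, ∃ T ∈ Syn (Proc.par B O).hide, pOmega A S O = pOmega B T O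

theorem mayEquiv_and_mustEquiv_of_matches {A B : Proc}
    (h : ∀ O, IsTest {A, B} O → Matches A B O ∧ Matches B A O) :
    MayEquiv A B ∧ MustEquiv A B := by
  have h' : ∀ O, IsTest {B, A} O → Matches A B O ∧ Matches B A O := fun O hO =>
    h O (by rwa [Set.pair_comm])
  refine ⟨⟨fun O hO S hS => ?_, fun O hO S hS => ?_⟩, ⟨fun O hO S hS => ?_, fun O hO S hS => ?_⟩⟩
  · exact ((h O hO).1 S hS).imp fun T hT => ⟨hT.1, hT.2.le⟩
  · exact ((h' O hO).2 S hS).imp fun T hT => ⟨hT.1, hT.2.le⟩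
  · exact ((h O hO).2 S hS).imp fun T hT => ⟨hT.1, hT.2.ge⟩
  · exact ((h' O hO).1 S hS).imp fun T hT => ⟨hT.1, hT.2.ge⟩

theorem matches_outer_inner (hctx : HoleCtx fun X => C.fill X)
    (hpre : ∀ i, LDisj C.labels (Proc.pre l₁ .tau (P i)).labels)
    (hpsum : LDisj C.labels (Proc.psum l w P).labels)
    (hO : IsTest {outer w P (fun X => C.fill X) l l₁, inner w P (fun X => C.fill X) l} O) :
    Matches (outer w P (fun X => C.fill X) l l₁) (inner w P (fun X => C.fill X) l) O ∧
      Matches (inner w P (fun X => C.fill X) l) (outer w P (fun X => C.fill X) l l₁) O := by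
  have h := Separated.of_isTest hctx hpre hpsum hO
  have hch := mem_chans_outer_iff (w := w) (P := P) (C := C) (l := l) (l₁ := l₁) (O := O)
  have hR := hO.1.stepsDet
  constructor
  · intro S hS
    -- Unfolding `hide` gives `beside` with the channels of the outer composition. The inner process
    -- is first compared under this same list, which is then replaced by its own.
    obtain ⟨T, hT, hv⟩ := h.exists_sched_inner hR (.refl _) (mem_syn_iff.1 hS)
    refine ⟨T, live_resAll_congr hch hT, ?_⟩
    rw [pOmega_eq_iSup_val, pOmega_eq_iSup_val]
    refine hv.trans (iSup_congr fun n => ?_)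
    exact val_resAll_congr hch n _ T
  · intro T hT
    obtain ⟨S, hS, hv⟩ := h.exists_sched_outer hR (.refl _) (mem_syn_iff.1 hT)
    refine ⟨S, live_resAll_congr (fun a => (hch a).symm) hS, ?_⟩
    rw [pOmega_eq_iSup_val, pOmega_eq_iSup_val]
    refine hv.symm.trans (iSup_congr fun n => ?_)
    exact (val_resAll_congr hch n _ S).symm

end

end CCS

theorem mainTheorem1 (P Q : CCS.Proc) (C : CCS.Ctx) (l l₁ : CCS.Label)
    (p : ℝ≥0) (hp : p ≤ 1)
    (hP : CCS.Deterministic P) (hQ : CCS.Deterministic Q)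
    (hC : CCS.FreshLabels C.labels
      {CCS.Proc.pre l₁ .tau P, CCS.Proc.pre l₁ .tau Q, CCS.Proc.bsum l p hp P Q})
    (hbang : C.BangFree) :
    CCS.MayEquiv
        (CCS.Proc.bsum l p hp (C.fill (.pre l₁ .tau P)) (C.fill (.pre l₁ .tau Q)))
        (C.fill (CCS.Proc.bsum l p hp P Q)) ∧
      CCS.MustEquiv
        (CCS.Proc.bsum l p hp (C.fill (.pre l₁ .tau P)) (C.fill (.pre l₁ .tau Q)))
        (C.fill (CCS.Proc.bsum l p hp P Q)) := by
  obtain ⟨hlin, hfresh⟩ := hC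
  -- Both summands of the binary choice are put in the form of one context filled by an indexed
  -- family, so that the result for finite sums applies.
  have e : ![C.fill (.pre l₁ .tau P), C.fill (.pre l₁ .tau Q)] =
      fun i => C.fill (.pre l₁ .tau (![P, Q] i)) := by
    funext i
    fin_cases i <;> rfl
  rw [CCS.Proc.bsum, e]
  refine CCS.mayEquiv_and_mustEquiv_of_matches fun O hO =>
    CCS.matches_outer_inner (CCS.Ctx.holeCtx_fill hbang hlin) (fun i => ?_) ?_ hO
  · intro L hL M hM
    fin_cases i
    · exact hfresh L hL _ (.inl rfl) M hM
    · exact hfresh L hL _ (.inr (.inl rfl)) M hM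
  · exact fun L hL M hM => hfresh L hL _ (.inr (.inr rfl)) M hM
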